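/- Let $n\in\mathbb N$ and $\alpha,\beta\in\mathbb R$ with $\alpha,\beta,\alpha+\beta\notin\mathbb Z$, $\alpha>-n$, $\beta>-n$ and $\alpha+\beta+n<-1$. Let $$P_n^{(\alpha,\beta)}(z)=2^{-n}\sum_{k=0}^n\binom{n+\alpha}{n-k}\binom{n+\beta}{k}(z-1)^k(z+1)^{n-k}$$ be the Jacobi polynomial, let $[c]$ denote the largest integer $\le c$, and let $\mathbb P_m$ be the set of complex polynomials of degree $\le m$ ($\mathbb P_m=\emptyset$ if $m<0$). Let $\Gamma_{-1},\Gamma_1,\Gamma_\infty$ be arbitrary locally rectifiable curves such that, apart from their end points, * $\Gamma_{-1}$ runs from $-1+i0$ to $-1-i0$ inside $\mathbb C\setminus(-\infty,1]$, * $\Gamma_1$ runs from $1-i0$ to $1+i0$ inside $\mathbb C\setminus[-1,+\infty)$, * $\Gamma_\infty$ runs inside $\mathbb C\setminus\big((-\infty,-1]\cup[1,+\infty)\big)$, coming from $\infty$ through the upper half plane and going to $\infty$ through the lower half plane. Here $\pm1\pm i0$ means that the curve tends to $\pm1$ and lies in the corresponding half plane near that end. On each curve let $w(t;a,b)$ be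 any continuous branch of $(1-t)^a(t+1)^b$ with the parameters that occur below; integrals along the curves are improper at the end points. Then $P_n^{(\alpha,\beta)}$ has degree exactly $n$, and the polynomial $p=P_n^{(\alpha,\beta)}$ satisfies (all integrals being convergent) $$\int_{\Gamma_{-1}}q(t)\,p(t)\,w(t;\alpha,\beta+[-\beta])\,dt=0,\qquad q\in\mathbb P_{n-[-\beta]-1},$$ $$\int_{\Gamma_{1}}q(t)\,p(t)\,w(t;\alpha+[-\alpha],\beta)\,dt=0,\qquad q\in\mathbb P_{n-[-\alpha]-1},$$ $$\int_{\Gamma_{\infty}}q(t)\,p(t)\,w(t;\alpha,\beta)\,dt=0,\qquad q\in\mathbb P_{[-\alpha]+[-\beta]-n-1}.$$ Moreover, these conditions characterize $P_n^{(\alpha,\beta)}$ up to a constant factor: every complex polynomial $p$ of degree $\le n$ that satisfies all three sets of conditions is of the form $p=c\,P_n^{(\alpha,\beta)}$ with $c\in\mathbb C$. -/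

import Mathlib

open Filter Topology Polynomial

noncomputable section

/-- The Jacobi polynomial `P_n^{(α,β)}`, for arbitrary complex parameters, by its explicit formula
`2^{-n} ∑_{k=0}^n binom(n+α, n-k) binom(n+β, k) (z-1)^k (z+1)^{n-k}`
(`Ring.choose` is the generalized binomial coefficient). -/
def jacobiPoly (n : ℕ) (α β : ℂ) : ℂ[X] :=
  C ((2 : ℂ)⁻¹ ^ n) * ∑ k ∈ Finset.range (n + 1),
    C (Ring.choose ((n : ℂ) + α) (n - k) * Ring.choose ((n : ℂ) + β) k) *
      (X - 1) ^ k * (X + 1) ^ (n - k)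

/-- Curves are parametrized by the open interval `(0,1)`; the end points, which may be
singularities of the integrand or `∞`, are limits. The curve is locally rectifiable: `γ` is
absolutely continuous on every compact subinterval. Every piecewise `C¹` curve is of this form. -/
def IsOpenCurve (γ : ℝ → ℂ) : Prop :=
  ∀ a b : ℝ, 0 < a → a ≤ b → b < 1 → AbsolutelyContinuousOnInterval γ a b

/-- `Γ₁`: a curve from `1 - i0` to `1 + i0` (hence clockwise around `-1`) inside
`ℂ ∖ [-1, +∞)`. -/
structure IsGammaOne (γ : ℝ → ℂ) : Prop where
  curve : IsOpenCurve γ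
  avoids : ∀ s ∈ Set.Ioo (0 : ℝ) 1, ∀ x : ℝ, -1 ≤ x → γ s ≠ (x : ℂ)
  start : Tendsto γ (𝓝[>] 0) (𝓝 1)
  start_side : ∀ᶠ s in 𝓝[>] (0 : ℝ), (γ s).im < 0
  finish : Tendsto γ (𝓝[<] 1) (𝓝 1)
  finish_side : ∀ᶠ s in 𝓝[<] (1 : ℝ), 0 < (γ s).im

/-- `Γ₋₁`: a curve from `-1 + i0` to `-1 - i0` (hence clockwise around `1`) inside
`ℂ ∖ (-∞, 1]`. -/
structure IsGammaNegOne (γ : ℝ → ℂ) : Prop where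
  curve : IsOpenCurve γ
  avoids : ∀ s ∈ Set.Ioo (0 : ℝ) 1, ∀ x : ℝ, x ≤ 1 → γ s ≠ (x : ℂ)
  start : Tendsto γ (𝓝[>] 0) (𝓝 (-1))
  start_side : ∀ᶠ s in 𝓝[>] (0 : ℝ), 0 < (γ s).im
  finish : Tendsto γ (𝓝[<] 1) (𝓝 (-1))
  finish_side : ∀ᶠ s in 𝓝[<] (1 : ℝ), (γ s).im < 0

/-- `Γ_∞`: a curve inside `ℂ ∖ ((-∞, -1] ∪ [1, +∞))` that comes from `∞` through the upper half
plane and goes to `∞` through the lower half plane. -/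
structure IsGammaInfty (γ : ℝ → ℂ) : Prop where
  curve : IsOpenCurve γ
  avoids : ∀ s ∈ Set.Ioo (0 : ℝ) 1, ∀ x : ℝ, (x ≤ -1 ∨ 1 ≤ x) → γ s ≠ (x : ℂ)
  start : Tendsto (fun s => ‖γ s‖) (𝓝[>] 0) atTop
  start_side : ∀ᶠ s in 𝓝[>] (0 : ℝ), 0 < (γ s).im
  finish : Tendsto (fun s => ‖γ s‖) (𝓝[<] 1) atTop
  finish_side : ∀ᶠ s in 𝓝[<] (1 : ℝ), (γ s).im < 0

/-- `w` is a continuous branch along `γ` of the multivalued weight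
`w(z; α, β) = (1-z)^α (z+1)^β = exp (α log (1-z) + β log (z+1))`. -/
def IsWeightBranch (α β : ℂ) (γ w : ℝ → ℂ) : Prop :=
  ContinuousOn w (Set.Ioo 0 1) ∧
    ∀ s ∈ Set.Ioo (0 : ℝ) 1, ∃ l₁ l₂ : ℂ,
      Complex.exp l₁ = 1 - γ s ∧ Complex.exp l₂ = γ s + 1 ∧
        w s = Complex.exp (α * l₁ + β * l₂)

/-- The contour integral `∫_γ f(t) w(t) dt` of a polynomial `f` against a branch `w` of the weight
along `γ` converges and has the value `I`. It is improper at both ends of the curve. -/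
def HasContourIntegral (γ w : ℝ → ℂ) (f : ℂ[X]) (I : ℂ) : Prop :=
  Tendsto (fun ab : ℝ × ℝ => ∫ s in ab.1..ab.2, f.eval (γ s) * w s * deriv γ s)
    ((𝓝[>] (0 : ℝ)) ×ˢ (𝓝[<] (1 : ℝ))) (𝓝 I)

/-- `∫_γ q(t) p(t) w(t) dt = 0` for all complex polynomials `q` of degree at most `m`
(no condition if `m < 0`). -/
def OrthogonalUpTo (γ w : ℝ → ℂ) (m : ℤ) (p : ℂ[X]) : Prop :=
  ∀ q : ℂ[X], (q.natDegree : ℤ) ≤ m → HasContourIntegral γ w (q * p) 0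

/-- The three sets of orthogonality conditions, on `Γ₋₁`, `Γ₁` and `Γ_∞`, with degrees governed by
`n`, `[-α]` and `[-β]`. -/
def MultipleOrthogonality (n : ℕ) (α β : ℝ) (γm wm γp wp γi wi : ℝ → ℂ) (p : ℂ[X]) : Prop :=
  OrthogonalUpTo γm wm (n - ⌊-β⌋ - 1) p ∧
    OrthogonalUpTo γp wp (n - ⌊-α⌋ - 1) p ∧
      OrthogonalUpTo γi wi (⌊-α⌋ + ⌊-β⌋ - n - 1) p

end

/-! All three contours test the same algebraic property. Since `a + b` is not an integer, `jacobiOp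
a b` raises degrees by exactly one, so every polynomial is uniquely an exact one plus a constant
`c`. Along a contour on which the boundary terms vanish, its integral against the weight is `c`
times the integral of the weight alone. If the latter is nonzero, the integral of the polynomial
vanishes exactly when the polynomial is exact (`IsLogPair.hasContourIntegral_zero_iff`).

That the weight has a nonzero integral is shown for Γ₁ (`hasNonzeroJump`): contiguous relations move
both exponents to positive values, where an Euler integral supplies a primitive whose jump is
computable. Γ₋₁ reduces to this case by `t ↦ -t`, and Γ_∞ by a Möbius map.

Let `A = [-α]`, `B = [-β]`. Powers of `1 - t` and `1 + t` pass between weight and polynomial without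
affecting exactness. The conditions therefore say that `q p` is exact for the parameters `α, β`
whenever `q` lies in `(1+X)^B ℙ_{n-B-1}`, `(1-X)^A ℙ_{n-A-1}` or `ℙ_{A+B-n-1}`. The sum of these
spaces is `ℙ_{n-1}` (`exists_eq_pow_mul_add_pow_mul_add`), so together they say that `q p` is exact
for all `q` of degree less than `n`. Integration by parts lowers `n` and raises both parameters by
one, and the ladder relation `jacobiOp_jacobiPoly` identifies the solutions as the multiples of the
Jacobi polynomial (`forall_isJacobiExact_mul_iff`). -/

/-! ### Exact polynomials for a Jacobi weight. -/

/-- The operator `f ↦ (1 - X²) f' + ((b - a) - (a + b + 2) X) f`, which is conjugate to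
differentiation: `(w(t; a+1, b+1) f(t))' = w(t; a, b) (jacobiOp a b f)(t)`. -/
noncomputable def jacobiOp (a b : ℂ) (f : ℂ[X]) : ℂ[X] :=
  (1 - X ^ 2) * derivative f + (C (b - a) - C (a + b + 2) * X) * f

/-- `g` is exact if `g(t) w(t; a, b)` has a primitive of the form `f(t) w(t; a+1, b+1)`. -/
def IsJacobiExact (a b : ℂ) (g : ℂ[X]) : Prop := ∃ f, jacobiOp a b f = g

theorem jacobiOp_add (a b : ℂ) (f g : ℂ[X]) :
    jacobiOp a b (f + g) = jacobiOp a b f + jacobiOp a b g := by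
  simp only [jacobiOp, derivative_add]; ring

theorem jacobiOp_C_mul (a b c : ℂ) (f : ℂ[X]) :
    jacobiOp a b (C c * f) = C c * jacobiOp a b f := by
  simp only [jacobiOp, derivative_C_mul]; ring

theorem jacobiOp_sum {ι : Type*} (a b : ℂ) (s : Finset ι) (f : ι → ℂ[X]) :
    jacobiOp a b (∑ i ∈ s, f i) = ∑ i ∈ s, jacobiOp a b (f i) := by
  simp only [jacobiOp, derivative_sum, Finset.mul_sum, Finset.sum_add_distrib]

theorem jacobiOp_mul (a b : ℂ) (q f : ℂ[X]) :
    jacobiOp a b (q * f) = q * jacobiOp a b f + (1 - X ^ 2) * (derivative q * f) := by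
  simp only [jacobiOp, derivative_mul]; ring

/-- Multiplied by `w(t; a, b)`, both sides are the derivative of `w(t; a+2, b+1) f(t)`. -/
theorem one_sub_X_mul_jacobiOp (a b : ℂ) (f : ℂ[X]) :
    (1 - X) * jacobiOp (a + 1) b f = jacobiOp a b ((1 - X) * f) := by
  simp only [jacobiOp, derivative_mul, derivative_sub, derivative_one, derivative_X, C_sub, C_add,
    C_1]
  ring

theorem one_add_X_mul_jacobiOp (a b : ℂ) (f : ℂ[X]) :
    (1 + X) * jacobiOp a (b + 1) f = jacobiOp a b ((1 + X) * f) := by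
  simp only [jacobiOp, derivative_mul, derivative_add, derivative_one, derivative_X, C_sub, C_add,
    C_1]
  ring

theorem natDegree_jacobiOp_le (a b : ℂ) {f : ℂ[X]} {d : ℕ} (hf : f.natDegree ≤ d) :
    (jacobiOp a b f).natDegree ≤ d + 1 := by
  rw [natDegree_le_iff_coeff_eq_zero]
  intro N hN
  have h0 : ∀ k, d < k → f.coeff k = 0 := fun k hk =>
    coeff_eq_zero_of_natDegree_lt (by omega)
  obtain ⟨k, rfl⟩ : ∃ k, N = k + 2 := ⟨N - 2, by omega⟩
  have : jacobiOp a b f = derivative f - derivative f * X ^ 2 + C (b - a) * f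
      - C (a + b + 2) * (f * X) := by simp only [jacobiOp]; ring
  rw [this]
  simp only [coeff_add, coeff_sub, coeff_C_mul, coeff_mul_X_pow, coeff_derivative]
  rw [show k + 2 = (k + 1) + 1 from rfl, coeff_mul_X, h0 (k + 1 + 1) (by omega),
    h0 (k + 1) (by omega), h0 (k + 1 + 1 + 1) (by omega)]
  simp

theorem coeff_jacobiOp (a b : ℂ) {f : ℂ[X]} {d : ℕ} (hf : f.natDegree ≤ d) :
    (jacobiOp a b f).coeff (d + 1) = -(d + a + b + 2) * f.coeff d := by
  have h0 : ∀ k, d < k → f.coeff k = 0 := fun k hk =>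
    coeff_eq_zero_of_natDegree_lt (by omega)
  have : jacobiOp a b f = derivative f - derivative f * X ^ 2 + C (b - a) * f
      - C (a + b + 2) * (f * X) := by simp only [jacobiOp]; ring
  rw [this]
  simp only [coeff_add, coeff_sub, coeff_C_mul, coeff_mul_X_pow', coeff_derivative, coeff_mul_X,
    h0 (d + 1) (by omega), h0 (d + 1 + 1) (by omega)]
  rcases d with _ | d
  · simp; ring
  · simp; ring

theorem natDegree_jacobiOp {a b : ℂ} (hab : ∀ m : ℤ, a + b ≠ m) {f : ℂ[X]} (hf : f ≠ 0) :
    (jacobiOp a b f).natDegree = f.natDegree + 1 := by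
  refine le_antisymm (natDegree_jacobiOp_le a b le_rfl) (le_natDegree_of_ne_zero ?_)
  rw [coeff_jacobiOp a b le_rfl]
  refine mul_ne_zero (fun h => hab (-(f.natDegree + 2)) ?_) (by simpa using hf)
  push_cast
  linear_combination -h

/-- Leading terms of positive degree can be removed one by one because the factor `d + a + b + 2` in
`coeff_jacobiOp` never vanishes. For `N = 0` the bound `N - 1` truncates to `0`, and `f = 0` serves.
-/
theorem exists_jacobiOp_add_C {a b : ℂ} (hab : ∀ m : ℤ, a + b ≠ m) (N : ℕ) :
    ∀ g : ℂ[X], g.natDegree ≤ N → ∃ f c, f.natDegree ≤ N - 1 ∧ g = jacobiOp a b f + C c := by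
  induction N with
  | zero =>
    intro g hg
    exact ⟨0, g.coeff 0, by simp, by simpa [jacobiOp] using eq_C_of_natDegree_le_zero hg⟩
  | succ d ih =>
    intro g hg
    have hne : ((d : ℂ) + a + b + 2) ≠ 0 := fun h => hab (-(d + 2)) (by
      push_cast; linear_combination h)
    set e : ℂ := -g.coeff (d + 1) / (d + a + b + 2) with he
    have hdeg : (C e * X ^ d : ℂ[X]).natDegree ≤ d := natDegree_C_mul_X_pow_le e d
    obtain ⟨f, c, hf, hg'⟩ := ih (g - jacobiOp a b (C e * X ^ d)) (by
      rw [natDegree_le_iff_coeff_eq_zero]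
      intro k hk
      rcases (Nat.succ_le_of_lt hk).eq_or_lt with rfl | hk'
      · rw [coeff_sub, Nat.succ_eq_add_one, coeff_jacobiOp a b hdeg]
        simp only [coeff_C_mul, coeff_X_pow, if_true, he]
        field_simp
        ring
      · rw [coeff_sub, coeff_eq_zero_of_natDegree_lt (lt_of_le_of_lt hg hk'),
          coeff_eq_zero_of_natDegree_lt
            (lt_of_le_of_lt (natDegree_jacobiOp_le a b hdeg) hk'), sub_zero])
    refine ⟨f + C e * X ^ d, c, ?_, ?_⟩
    · refine (natDegree_add_le _ _).trans (max_le ?_ ?_) <;> omega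
    · rw [jacobiOp_add]; linear_combination hg'

theorem IsJacobiExact.add {a b : ℂ} {f g : ℂ[X]} (hf : IsJacobiExact a b f)
    (hg : IsJacobiExact a b g) : IsJacobiExact a b (f + g) := by
  obtain ⟨f, rfl⟩ := hf
  obtain ⟨g, rfl⟩ := hg
  exact ⟨f + g, jacobiOp_add a b f g⟩

theorem IsJacobiExact.C_mul {a b : ℂ} {f : ℂ[X]} (c : ℂ) (hf : IsJacobiExact a b f) :
    IsJacobiExact a b (C c * f) := by
  obtain ⟨f, rfl⟩ := hf
  exact ⟨C c * f, jacobiOp_C_mul a b c f⟩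

theorem IsJacobiExact.sub {a b : ℂ} {f g : ℂ[X]} (hf : IsJacobiExact a b f)
    (hg : IsJacobiExact a b g) : IsJacobiExact a b (f - g) := by
  simpa [sub_eq_add_neg] using hf.add (hg.C_mul (-1))

theorem isJacobiExact_C {a b : ℂ} (hab : ∀ m : ℤ, a + b ≠ m) {c : ℂ}
    (h : IsJacobiExact a b (C c)) : c = 0 := by
  obtain ⟨f, hf⟩ := h
  by_cases h0 : f = 0
  · subst h0
    simpa [jacobiOp] using hf.symm
  · have := natDegree_jacobiOp hab h0
    rw [hf, natDegree_C] at this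
    omega

theorem jacobiOp_eq_of_natDegree_le_one {a b : ℂ} (hab : ∀ m : ℤ, a + b ≠ m) {f : ℂ[X]}
    (h : (jacobiOp a b f).natDegree ≤ 1) :
    ∃ x, jacobiOp a b f = C x * (C (b - a) - C (a + b + 2) * X) := by
  by_cases h0 : f = 0
  · exact ⟨0, by simp [h0, jacobiOp]⟩
  · have hd := natDegree_jacobiOp hab h0
    refine ⟨f.coeff 0, ?_⟩
    rw [eq_C_of_natDegree_le_zero (show f.natDegree ≤ 0 by omega)]
    simp [jacobiOp, mul_comm]

/-- For the forward direction, subtracting an exact part of `g` leaves `C c * (1 - X)` exact. An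
exact polynomial of degree at most one is a multiple of `jacobiOp a b 1`, whose value at `1` is
`-2(a+1) ≠ 0`, whereas `1 - X` vanishes there; hence `c = 0`. -/
theorem isJacobiExact_one_sub_X_mul_iff {a b : ℂ} (ha : a ≠ -1) (hab : ∀ m : ℤ, a + b ≠ m)
    (g : ℂ[X]) : IsJacobiExact a b ((1 - X) * g) ↔ IsJacobiExact (a + 1) b g := by
  have hab' : ∀ m : ℤ, a + 1 + b ≠ m := fun m h => hab (m - 1) (by
    push_cast; linear_combination h)
  refine ⟨fun h => ?_, fun ⟨f, hf⟩ => ⟨(1 - X) * f, by rw [← hf, one_sub_X_mul_jacobiOp]⟩⟩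
  obtain ⟨f, c, -, hg⟩ := exists_jacobiOp_add_C hab' _ g le_rfl
  obtain ⟨h, hh⟩ : IsJacobiExact a b (C c * (1 - X)) := by
    have := h.sub ⟨_, (one_sub_X_mul_jacobiOp a b f).symm⟩
    rwa [hg, show (1 - X) * (jacobiOp (a + 1) b f + C c) - (1 - X) * jacobiOp (a + 1) b f
      = C c * (1 - X) by ring] at this
  obtain ⟨x, hx⟩ := jacobiOp_eq_of_natDegree_le_one hab (f := h) (by
    rw [hh]; compute_degree)
  rw [hh] at hx
  have h1 := congrArg (eval 1) hx
  have h0 := congrArg (eval 0) hx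
  simp only [eval_mul, eval_C, eval_sub, eval_one, eval_X] at h1 h0
  have hx0 : x = 0 := by
    have : x * (a + 1) = 0 := by linear_combination (1 / 2 : ℂ) * h1
    exact (mul_eq_zero.1 this).resolve_right fun h => ha (by linear_combination h)
  have hc : c = 0 := by rw [hx0] at h0; linear_combination h0
  exact ⟨f, by simp [hg, hc]⟩

theorem isJacobiExact_one_add_X_mul_iff {a b : ℂ} (hb : b ≠ -1) (hab : ∀ m : ℤ, a + b ≠ m)
    (g : ℂ[X]) : IsJacobiExact a b ((1 + X) * g) ↔ IsJacobiExact a (b + 1) g := by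
  have hab' : ∀ m : ℤ, a + (b + 1) ≠ m := fun m h => hab (m - 1) (by
    push_cast; linear_combination h)
  refine ⟨fun h => ?_, fun ⟨f, hf⟩ => ⟨(1 + X) * f, by rw [← hf, one_add_X_mul_jacobiOp]⟩⟩
  obtain ⟨f, c, -, hg⟩ := exists_jacobiOp_add_C hab' _ g le_rfl
  obtain ⟨h, hh⟩ : IsJacobiExact a b (C c * (1 + X)) := by
    have := h.sub ⟨_, (one_add_X_mul_jacobiOp a b f).symm⟩
    rwa [hg, show (1 + X) * (jacobiOp a (b + 1) f + C c) - (1 + X) * jacobiOp a (b + 1) f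
      = C c * (1 + X) by ring] at this
  obtain ⟨x, hx⟩ := jacobiOp_eq_of_natDegree_le_one hab (f := h) (by
    rw [hh]; compute_degree)
  rw [hh] at hx
  have h1 := congrArg (eval (-1)) hx
  have h0 := congrArg (eval 0) hx
  simp only [eval_mul, eval_C, eval_sub, eval_add, eval_one, eval_X] at h1 h0
  have hx0 : x = 0 := by
    have : x * (b + 1) = 0 := by linear_combination (-1 / 2 : ℂ) * h1
    exact (mul_eq_zero.1 this).resolve_right fun h => hb (by linear_combination h)
  have hc : c = 0 := by rw [hx0] at h0; linear_combination h0
  exact ⟨f, by simp [hg, hc]⟩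

theorem isJacobiExact_one_sub_X_pow_mul_iff {a b : ℂ} (ha : ∀ m : ℤ, a ≠ m)
    (hab : ∀ m : ℤ, a + b ≠ m) (k : ℕ) (g : ℂ[X]) :
    IsJacobiExact a b ((1 - X) ^ k * g) ↔ IsJacobiExact (a + k) b g := by
  induction k generalizing g with
  | zero => simp
  | succ k ih =>
    rw [pow_succ, mul_assoc, ih, isJacobiExact_one_sub_X_mul_iff]
    · push_cast; rw [add_assoc]
    · exact fun h => ha (-1 - k) (by push_cast; linear_combination h)
    · exact fun m h => hab (m - k) (by push_cast; linear_combination h)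

theorem isJacobiExact_one_add_X_pow_mul_iff {a b : ℂ} (hb : ∀ m : ℤ, b ≠ m)
    (hab : ∀ m : ℤ, a + b ≠ m) (k : ℕ) (g : ℂ[X]) :
    IsJacobiExact a b ((1 + X) ^ k * g) ↔ IsJacobiExact a (b + k) g := by
  induction k generalizing g with
  | zero => simp
  | succ k ih =>
    rw [pow_succ, mul_assoc, ih, isJacobiExact_one_add_X_mul_iff]
    · push_cast; rw [add_assoc]
    · exact fun h => hb (-1 - k) (by push_cast; linear_combination h)
    · exact fun m h => hab (m - k) (by push_cast; linear_combination h)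

theorem isJacobiExact_one_sub_X_sq_mul_iff {a b : ℂ} (ha : ∀ m : ℤ, a ≠ m) (hb : ∀ m : ℤ, b ≠ m)
    (hab : ∀ m : ℤ, a + b ≠ m) (g : ℂ[X]) :
    IsJacobiExact a b ((1 - X ^ 2) * g) ↔ IsJacobiExact (a + 1) (b + 1) g := by
  rw [show (1 - X ^ 2) * g = (1 - X) * ((1 + X) * g) by ring, isJacobiExact_one_sub_X_mul_iff,
    isJacobiExact_one_add_X_mul_iff]
  · exact fun h => hb (-1) (by push_cast; exact h)
  · exact fun m h => hab (m - 1) (by push_cast; linear_combination h)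
  · exact fun h => ha (-1) (by push_cast; exact h)
  · exact hab

/-! ### The ladder relation and the degree of the Jacobi polynomial. -/

theorem Ring.succ_mul_choose_succ (x : ℂ) (k : ℕ) :
    ((k : ℂ) + 1) * Ring.choose x (k + 1) = Ring.choose x k * (x - k) := by
  have := Ring.choose_smul_choose x (Nat.le_succ k)
  simpa using this

theorem jacobiOp_pow_mul_pow (a b : ℂ) {k m : ℕ} (hk : k ≤ m) :
    jacobiOp a b ((X - 1) ^ k * (X + 1) ^ (m - k)) =
      -(C (k + a + 1) * (X - 1) ^ k * (X + 1) ^ (m + 1 - k) +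
        C (((m - k : ℕ) : ℂ) + b + 1) * (X - 1) ^ (k + 1) * (X + 1) ^ (m - k)) := by
  obtain ⟨j, rfl⟩ := Nat.exists_eq_add_of_le hk
  rw [show k + j - k = j by omega, show k + j + 1 - k = j + 1 by omega]
  have h1 : ((X : ℂ[X]) - 1) * derivative ((X - 1) ^ k) = C (k : ℂ) * (X - 1) ^ k := by
    rcases k with _ | k
    · simp
    · rw [derivative_pow]; simp; ring
  have h2 : ((X : ℂ[X]) + 1) * derivative ((X + 1) ^ j) = C (j : ℂ) * (X + 1) ^ j := by
    rcases j with _ | j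
    · simp
    · rw [derivative_pow]; simp; ring
  simp only [jacobiOp, derivative_mul, C_sub, C_add, C_1, show (C 2 : ℂ[X]) = 2 from rfl]
  linear_combination (-(X + 1) ^ (j + 1) : ℂ[X]) * h1 - (X - 1) ^ (k + 1) * h2

/-- The ladder relation behind the Rodrigues formula. -/
theorem jacobiOp_jacobiPoly (m : ℕ) (a b : ℂ) :
    jacobiOp a b (jacobiPoly m (a + 1) (b + 1)) = C (-2 * ((m : ℂ) + 1)) * jacobiPoly (m + 1) a b := by
  have hx : ∀ c : ℂ, (m : ℂ) + (c + 1) = ((m + 1 : ℕ) : ℂ) + c := fun c => by push_cast; ring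
  have hL : ∀ k ∈ Finset.range (m + 1),
      jacobiOp a b (C (Ring.choose ((m : ℂ) + (a + 1)) (m - k) *
        Ring.choose ((m : ℂ) + (b + 1)) k) * (X - 1) ^ k * (X + 1) ^ (m - k)) =
      -(C (((m + 1 - k : ℕ) : ℂ) * (Ring.choose (((m + 1 : ℕ) : ℂ) + a) (m + 1 - k) *
          Ring.choose (((m + 1 : ℕ) : ℂ) + b) k)) * (X - 1) ^ k * (X + 1) ^ (m + 1 - k)) +
      -(C (((k + 1 : ℕ) : ℂ) * (Ring.choose (((m + 1 : ℕ) : ℂ) + a) (m + 1 - (k + 1)) *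
          Ring.choose (((m + 1 : ℕ) : ℂ) + b) (k + 1))) * (X - 1) ^ (k + 1) *
            (X + 1) ^ (m + 1 - (k + 1))) := by
    intro k hk
    obtain ⟨j, rfl⟩ := Nat.exists_eq_add_of_le (Nat.lt_succ_iff.1 (Finset.mem_range.1 hk))
    rw [mul_assoc, jacobiOp_C_mul, jacobiOp_pow_mul_pow a b (Nat.le_add_right k j), hx a, hx b,
      show k + j - k = j by omega, show k + j + 1 - k = j + 1 by omega,
      show k + j + 1 - (k + 1) = j by omega]
    have e1 := Ring.succ_mul_choose_succ (((k + j + 1 : ℕ) : ℂ) + a) j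
    have e2 := Ring.succ_mul_choose_succ (((k + j + 1 : ℕ) : ℂ) + b) k
    rw [show ((j + 1 : ℕ) : ℂ) * (Ring.choose (((k + j + 1 : ℕ) : ℂ) + a) (j + 1) *
          Ring.choose (((k + j + 1 : ℕ) : ℂ) + b) k) =
        Ring.choose (((k + j + 1 : ℕ) : ℂ) + a) j * Ring.choose (((k + j + 1 : ℕ) : ℂ) + b) k
          * (k + a + 1) by
      push_cast at e1 ⊢
      linear_combination Ring.choose ((k : ℂ) + j + 1 + b) k * e1,
      show ((k + 1 : ℕ) : ℂ) * (Ring.choose (((k + j + 1 : ℕ) : ℂ) + a) j *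
          Ring.choose (((k + j + 1 : ℕ) : ℂ) + b) (k + 1)) =
        Ring.choose (((k + j + 1 : ℕ) : ℂ) + a) j * Ring.choose (((k + j + 1 : ℕ) : ℂ) + b) k
          * (j + b + 1) by
      push_cast at e2 ⊢
      linear_combination Ring.choose ((k : ℂ) + j + 1 + a) j * e2]
    simp only [C_mul]
    ring
  -- Splitting `m + 1 = (m + 1 - k) + k` in the coefficient of each term reproduces the two families
  -- in `hL`, the second with its index shifted. The unmatched end terms, `k = m + 1` in the first
  -- family and `k = 0` in the second, have coefficient zero.
  have hR : ∀ k ∈ Finset.range (m + 1 + 1),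
      C ((m : ℂ) + 1) * (C (Ring.choose (((m + 1 : ℕ) : ℂ) + a) (m + 1 - k) *
          Ring.choose (((m + 1 : ℕ) : ℂ) + b) k) * (X - 1) ^ k * (X + 1) ^ (m + 1 - k)) =
      C (((m + 1 - k : ℕ) : ℂ) * (Ring.choose (((m + 1 : ℕ) : ℂ) + a) (m + 1 - k) *
          Ring.choose (((m + 1 : ℕ) : ℂ) + b) k)) * (X - 1) ^ k * (X + 1) ^ (m + 1 - k) +
      C ((k : ℂ) * (Ring.choose (((m + 1 : ℕ) : ℂ) + a) (m + 1 - k) *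
          Ring.choose (((m + 1 : ℕ) : ℂ) + b) k)) * (X - 1) ^ k * (X + 1) ^ (m + 1 - k) := by
    intro k hk
    have hk' := Nat.lt_succ_iff.1 (Finset.mem_range.1 hk)
    rw [show (m : ℂ) + 1 = ((m + 1 - k : ℕ) : ℂ) + k by rw [Nat.cast_sub hk']; push_cast; ring]
    simp only [C_mul, C_add]
    ring
  unfold jacobiPoly
  rw [jacobiOp_C_mul, jacobiOp_sum, Finset.sum_congr rfl hL, Finset.sum_add_distrib,
    Finset.sum_neg_distrib, Finset.sum_neg_distrib]
  have hS := Finset.sum_congr rfl hR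
  rw [← Finset.mul_sum, Finset.sum_add_distrib] at hS
  nth_rewrite 2 [Finset.sum_range_succ] at hS
  rw [Finset.sum_range_succ' (fun k => C ((k : ℂ) * (Ring.choose (((m + 1 : ℕ) : ℂ) + a)
    (m + 1 - k) * Ring.choose (((m + 1 : ℕ) : ℂ) + b) k)) * (X - 1) ^ k * (X + 1) ^ (m + 1 - k))]
    at hS
  simp only [Nat.sub_self, Nat.cast_zero, zero_mul, C_0, add_zero] at hS
  rw [← neg_add, ← hS, show (2 : ℂ)⁻¹ ^ m = 2 * 2⁻¹ ^ (m + 1) by rw [pow_succ]; ring]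
  simp only [C_mul, C_neg, neg_mul]
  ring

theorem jacobiPoly_zero (a b : ℂ) : jacobiPoly 0 a b = 1 := by
  simp [jacobiPoly]

/-- By the ladder relation, each step applies `jacobiOp`, which raises the degree by exactly one. -/
theorem jacobiPoly_ne_zero_and_natDegree (n : ℕ) {a b : ℂ} (hab : ∀ m : ℤ, a + b ≠ m) :
    jacobiPoly n a b ≠ 0 ∧ (jacobiPoly n a b).natDegree = n := by
  induction n generalizing a b with
  | zero => simp [jacobiPoly_zero]
  | succ n ih =>
    obtain ⟨h0, hd⟩ := @ih (a + 1) (b + 1) fun m h => hab (m - 2) (by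
      push_cast; linear_combination h)
    have h1 := natDegree_jacobiOp hab h0
    rw [jacobiOp_jacobiPoly, hd] at h1
    have hc : (-2 * ((n : ℂ) + 1)) ≠ 0 := mul_ne_zero (by norm_num) (Nat.cast_add_one_ne_zero n)
    rw [natDegree_C_mul hc] at h1
    exact ⟨fun h => by simp [h] at h1, h1⟩

/-! ### Algebraic orthogonality characterizes the Jacobi polynomial. -/

theorem exists_derivative_eq (q : ℂ[X]) {n : ℕ} (hq : q.natDegree < n) :
    ∃ r : ℂ[X], r.natDegree < n + 1 ∧ derivative r = q := by
  refine ⟨∑ i ∈ Finset.range n, C (q.coeff i / (i + 1)) * X ^ (i + 1), ?_, ?_⟩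
  · refine Nat.lt_succ_of_le (natDegree_sum_le_of_forall_le _ _ fun i hi => ?_)
    exact (natDegree_C_mul_X_pow_le _ _).trans (Finset.mem_range.1 hi)
  · rw [derivative_sum]
    conv_rhs => rw [q.as_sum_range' n hq]
    refine Finset.sum_congr rfl fun i _ => ?_
    rw [derivative_C_mul_X_pow, ← C_mul_X_pow_eq_monomial]
    have : ((i : ℂ) + 1) ≠ 0 := Nat.cast_add_one_ne_zero i
    push_cast
    rw [div_mul_cancel₀ _ this]

/-- The orthogonality relations `∫ q p w = 0`, `deg q < n`, in algebraic form, characterize the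
Jacobi polynomial. -/
theorem forall_isJacobiExact_mul_iff (n : ℕ) {a b : ℂ} (ha : ∀ m : ℤ, a ≠ m)
    (hb : ∀ m : ℤ, b ≠ m) (hab : ∀ m : ℤ, a + b ≠ m) {p : ℂ[X]} (hp : p.natDegree ≤ n) :
    (∀ q : ℂ[X], q.natDegree < n → IsJacobiExact a b (q * p)) ↔
      ∃ c, p = C c * jacobiPoly n a b := by
  induction n generalizing a b p with
  | zero =>
    exact ⟨fun _ => ⟨p.coeff 0, by simpa [jacobiPoly_zero] using eq_C_of_natDegree_le_zero hp⟩,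
      fun _ q hq => absurd hq (by omega)⟩
  | succ n ih =>
    have ha' : ∀ m : ℤ, a + 1 ≠ m := fun m h => ha (m - 1) (by push_cast; linear_combination h)
    have hb' : ∀ m : ℤ, b + 1 ≠ m := fun m h => hb (m - 1) (by push_cast; linear_combination h)
    have hab' : ∀ m : ℤ, a + 1 + (b + 1) ≠ m := fun m h => hab (m - 2) (by
      push_cast; linear_combination h)
    have hc : (-2 * ((n : ℂ) + 1)) ≠ 0 := mul_ne_zero (by norm_num) (Nat.cast_add_one_ne_zero n)
    constructor
    · intro h
      -- The condition for `q = 1` alone gives `p = jacobiOp a b f`; the remaining conditions become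
      -- orthogonality of `f` for the raised parameters.
      obtain ⟨f, hf⟩ := h 1 (by simp)
      rw [one_mul] at hf
      have hfd : f.natDegree ≤ n := by
        by_cases h0 : f = 0
        · simp [h0]
        · have := natDegree_jacobiOp hab h0
          rw [hf] at this; omega
      obtain ⟨c, hc'⟩ := (ih ha' hb' hab' hfd).1 fun q hq => by
        -- With `q = r'`, integration by parts reads `(1 - X²) r' f = jacobiOp a b (r f) - r p`,
        -- where both terms on the right are exact.
        obtain ⟨r, hr, rfl⟩ := exists_derivative_eq q hq
        rw [← isJacobiExact_one_sub_X_sq_mul_iff ha hb hab]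
        have := IsJacobiExact.sub ⟨r * f, rfl⟩ (h r hr)
        rwa [jacobiOp_mul, ← hf, add_sub_cancel_left] at this
      refine ⟨c * (-2 * (n + 1)), ?_⟩
      rw [← hf, hc', jacobiOp_C_mul, jacobiOp_jacobiPoly, ← mul_assoc, ← C_mul]
    · rintro ⟨c, rfl⟩ q hq
      have hP : jacobiPoly (n + 1) a b =
          C (-2 * ((n : ℂ) + 1))⁻¹ * jacobiOp a b (jacobiPoly n (a + 1) (b + 1)) := by
        rw [jacobiOp_jacobiPoly, ← mul_assoc, ← C_mul, inv_mul_cancel₀ hc, C_1, one_mul]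
      have h1 := (ih ha' hb' hab' (jacobiPoly_ne_zero_and_natDegree n hab').2.le).2
        ⟨1, by simp⟩ (derivative q)
      have h2 : IsJacobiExact a b
          ((1 - X ^ 2) * (derivative q * jacobiPoly n (a + 1) (b + 1))) := by
        rw [isJacobiExact_one_sub_X_sq_mul_iff ha hb hab]
        by_cases hq0 : q.natDegree = 0
        · rw [derivative_of_natDegree_zero hq0, zero_mul]
          exact ⟨0, by simp [jacobiOp]⟩
        · exact h1 (lt_of_lt_of_le (natDegree_derivative_lt hq0) (by omega))
      have h3 : IsJacobiExact a b (q * jacobiOp a b (jacobiPoly n (a + 1) (b + 1))) := by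
        have := IsJacobiExact.sub ⟨q * jacobiPoly n (a + 1) (b + 1), rfl⟩ h2
        rwa [jacobiOp_mul, add_sub_cancel_right] at this
      rw [hP, show q * (C c * (C (-2 * ((n : ℂ) + 1))⁻¹ *
          jacobiOp a b (jacobiPoly n (a + 1) (b + 1)))) =
        C c * (C (-2 * ((n : ℂ) + 1))⁻¹ * (q * jacobiOp a b (jacobiPoly n (a + 1) (b + 1))))
        by ring]
      exact (h3.C_mul _).C_mul _

/-! ### Decomposition of the polynomials of degree less than `n`. -/

theorem degree_lt_of_iterate_derivative_eq_zero {u : ℂ[X]} {k : ℕ}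
    (h : derivative^[k] u = 0) : u.degree < k := by
  rw [degree_lt_iff_coeff_zero]
  intro m hm
  have := congrArg (fun v => coeff v (m - k)) h
  simp only [coeff_iterate_derivative, Nat.sub_add_cancel hm, coeff_zero,
    nsmul_eq_mul, mul_eq_zero, Nat.cast_eq_zero, Nat.descFactorial_eq_zero_iff_lt] at this
  exact this.resolve_left (by omega)

theorem degree_iterate_derivative_lt {u : ℂ[X]} {n k : ℕ} (h : u.degree < n) :
    (derivative^[k] u).degree < (n - k : ℕ) := by
  rw [degree_lt_iff_coeff_zero] at h ⊢
  intro m hm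
  rw [coeff_iterate_derivative, h _ (by omega), smul_zero]

theorem natDegree_one_add_X : (1 + X : ℂ[X]).natDegree = 1 := by
  rw [add_comm]; exact natDegree_X_add_C 1

theorem natDegree_one_sub_X : (1 - X : ℂ[X]).natDegree = 1 := by
  rw [← natDegree_neg, neg_sub]; exact natDegree_X_sub_C 1

theorem one_add_X_ne_zero : (1 + X : ℂ[X]) ≠ 0 := fun h => by
  simpa [h] using natDegree_one_add_X

theorem one_sub_X_ne_zero : (1 - X : ℂ[X]) ≠ 0 := fun h => by
  simpa [h] using natDegree_one_sub_X

theorem isCoprime_one_add_X_one_sub_X : IsCoprime (1 + X : ℂ[X]) (1 - X) := by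
  refine ⟨C (1 / 2), C (1 / 2), ?_⟩
  rw [← mul_add, show (1 + X + (1 - X) : ℂ[X]) = C 2 by rw [show (C 2 : ℂ[X]) = 2 from rfl]; ring,
    ← C_mul]
  norm_num

theorem degree_pow_mul_lt {ℓ q : ℂ[X]} (hℓ : ℓ.natDegree = 1) {n k : ℕ} (hk : k ≤ n)
    (hq : q.degree < (n - k : ℕ)) : (ℓ ^ k * q).degree < n := by
  by_cases h0 : q = 0
  · simp [h0]
  have hℓ0 : ℓ ≠ 0 := fun h => by simp [h] at hℓ
  rw [degree_eq_natDegree h0, Nat.cast_lt] at hq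
  rw [degree_eq_natDegree (mul_ne_zero (pow_ne_zero _ hℓ0) h0), Nat.cast_lt,
    natDegree_mul (pow_ne_zero _ hℓ0) h0, natDegree_pow, hℓ]
  omega

theorem eq_zero_of_pow_mul_degree_lt {ℓ q : ℂ[X]} (hℓ : ℓ.natDegree = 1) {k m : ℕ} (hk : m ≤ k)
    (h : (ℓ ^ k * q).degree < m) : q = 0 := by
  by_contra h0
  have hℓ0 : ℓ ≠ 0 := fun h => by simp [h] at hℓ
  rw [degree_eq_natDegree (mul_ne_zero (pow_ne_zero _ hℓ0) h0), Nat.cast_lt,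
    natDegree_mul (pow_ne_zero _ hℓ0) h0, natDegree_pow, hℓ] at h
  omega

/-- Differentiating `k = A + B - n` times kills `q₃`. The `k`-th derivative of `(1+X)^B q₁` is then
divisible by both `(1+X)^(B-k)` and `(1-X)^(A-k)`, whose product has degree `n - k`, while its own
degree is less than `n - k`. So it vanishes, and `k ≤ A, B` forces `q₁ = q₂ = 0`. -/
theorem eq_zero_of_pow_mul_add_pow_mul_add_eq_zero {n A B : ℕ} (hA : A ≤ n) (hB : B ≤ n)
    (hAB : n ≤ A + B) {q₁ q₂ q₃ : ℂ[X]} (h1 : q₁.degree < (n - B : ℕ))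
    (h3 : q₃.degree < (A + B - n : ℕ))
    (h : (1 + X) ^ B * q₁ + (1 - X) ^ A * q₂ + q₃ = 0) : q₁ = 0 ∧ q₂ = 0 ∧ q₃ = 0 := by
  set k := A + B - n with hk
  have hD : derivative^[k] ((1 + X) ^ B * q₁) = -derivative^[k] ((1 - X) ^ A * q₂) := by
    have := congrArg (derivative^[k]) h
    rw [iterate_map_add, iterate_map_add,
      iterate_derivative_eq_zero_of_degree_lt h3, iterate_derivative_zero, add_zero] at this
    exact eq_neg_of_add_eq_zero_left this
  have hd1 : (1 + X) ^ (B - k) ∣ derivative^[k] ((1 + X) ^ B * q₁) :=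
    pow_sub_dvd_iterate_derivative_of_pow_dvd k (dvd_mul_right _ _)
  have hd2 : (1 - X) ^ (A - k) ∣ derivative^[k] ((1 + X) ^ B * q₁) := by
    rw [hD, dvd_neg]
    exact pow_sub_dvd_iterate_derivative_of_pow_dvd k (dvd_mul_right _ _)
  have hd := (isCoprime_one_add_X_one_sub_X.pow (m := B - k) (n := A - k)).mul_dvd hd1 hd2
  have hv : derivative^[k] ((1 + X) ^ B * q₁) = 0 := by
    refine eq_zero_of_dvd_of_degree_lt hd ?_
    refine (degree_iterate_derivative_lt (degree_pow_mul_lt natDegree_one_add_X hB h1)).trans_eq ?_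
    have hp1 : (1 + X : ℂ[X]) ^ (B - k) ≠ 0 := pow_ne_zero _ one_add_X_ne_zero
    have hp2 : (1 - X : ℂ[X]) ^ (A - k) ≠ 0 := pow_ne_zero _ one_sub_X_ne_zero
    rw [degree_eq_natDegree (mul_ne_zero hp1 hp2), natDegree_mul hp1 hp2, natDegree_pow,
      natDegree_pow, natDegree_one_add_X, natDegree_one_sub_X]
    congr 1
    omega
  have e1 : q₁ = 0 := eq_zero_of_pow_mul_degree_lt natDegree_one_add_X (by omega)
    (degree_lt_of_iterate_derivative_eq_zero hv)
  have e2 : q₂ = 0 := eq_zero_of_pow_mul_degree_lt natDegree_one_sub_X (by omega)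
    (degree_lt_of_iterate_derivative_eq_zero (neg_eq_zero.1 (hD.symm.trans hv)))
  refine ⟨e1, e2, ?_⟩
  simpa [e1, e2] using h

theorem finrank_degreeLT (n : ℕ) : Module.finrank ℂ (degreeLT ℂ n) = n := by
  rw [(degreeLTEquiv ℂ n).finrank_eq, Module.finrank_fin_fun]

/-- The map is injective by the preceding lemma, and the dimensions add up: `(n - B) + (n - A) + (A
+ B - n) = n`. -/
theorem exists_eq_pow_mul_add_pow_mul_add {n A B : ℕ} (hA : A ≤ n) (hB : B ≤ n)
    (hAB : n ≤ A + B) {q : ℂ[X]} (hq : q.degree < n) :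
    ∃ q₁ q₂ q₃ : ℂ[X], q₁.degree < (n - B : ℕ) ∧ q₂.degree < (n - A : ℕ) ∧
      q₃.degree < (A + B - n : ℕ) ∧ q = (1 + X) ^ B * q₁ + (1 - X) ^ A * q₂ + q₃ := by
  have hfin : ∀ m, Module.Finite ℂ (degreeLT ℂ m) := fun m =>
    Module.Finite.equiv (degreeLTEquiv ℂ m).symm
  have := hfin n
  have := hfin (n - B)
  have := hfin (n - A)
  have := hfin (A + B - n)
  let φ : (degreeLT ℂ (n - B) × degreeLT ℂ (n - A) × degreeLT ℂ (A + B - n)) →ₗ[ℂ] ℂ[X] :=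
    { toFun := fun v => (1 + X) ^ B * v.1.1 + (1 - X) ^ A * v.2.1.1 + v.2.2.1
      map_add' := fun v w => by simp; ring
      map_smul' := fun c v => by simp [smul_add] }
  have hinj : Function.Injective φ := by
    rw [← LinearMap.ker_eq_bot, LinearMap.ker_eq_bot']
    rintro ⟨⟨q₁, h1⟩, ⟨q₂, h2⟩, ⟨q₃, h3⟩⟩ h
    obtain ⟨e1, e2, e3⟩ := eq_zero_of_pow_mul_add_pow_mul_add_eq_zero hA hB hAB
      (mem_degreeLT.1 h1) (mem_degreeLT.1 h3) h
    subst e1 e2 e3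
    rfl
  have hle : LinearMap.range φ ≤ degreeLT ℂ n := by
    rintro _ ⟨⟨⟨q₁, h1⟩, ⟨q₂, h2⟩, ⟨q₃, h3⟩⟩, rfl⟩
    rw [mem_degreeLT] at *
    refine (degree_add_le _ _).trans_lt (max_lt ((degree_add_le _ _).trans_lt (max_lt ?_ ?_)) ?_)
    · exact degree_pow_mul_lt natDegree_one_add_X hB h1
    · exact degree_pow_mul_lt natDegree_one_sub_X hA h2
    · exact lt_of_lt_of_le h3 (by exact_mod_cast (by omega : A + B - n ≤ n))
  have hrange : LinearMap.range φ = degreeLT ℂ n := by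
    refine Submodule.eq_of_le_of_finrank_eq hle ?_
    rw [LinearMap.finrank_range_of_inj hinj]
    simp only [Module.finrank_prod, finrank_degreeLT]
    omega
  obtain ⟨⟨⟨q₁, h1⟩, ⟨q₂, h2⟩, ⟨q₃, h3⟩⟩, h⟩ : q ∈ LinearMap.range φ := by
    rw [hrange]; exact mem_degreeLT.2 hq
  exact ⟨q₁, q₂, q₃, mem_degreeLT.1 h1, mem_degreeLT.1 h2, mem_degreeLT.1 h3, h.symm⟩

/-! ### Calculus along absolutely continuous curves. -/

theorem LipschitzOnWith.comp_absolutelyContinuousOnInterval {X Y : Type*} [PseudoMetricSpace X]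
    [PseudoMetricSpace Y] {g : X → Y} {f : ℝ → X} {a b : ℝ} {K : NNReal} {s : Set X}
    (hg : LipschitzOnWith K g s) (hf : AbsolutelyContinuousOnInterval f a b)
    (hs : Set.MapsTo f (Set.uIcc a b) s) : AbsolutelyContinuousOnInterval (g ∘ f) a b := by
  have h0 : Tendsto (fun E : ℕ × (ℕ → ℝ × ℝ) =>
      (K : ℝ) * ∑ i ∈ Finset.range E.1, dist (f (E.2 i).1) (f (E.2 i).2))
      (AbsolutelyContinuousOnInterval.totalLengthFilter ⊓
        𝓟 (AbsolutelyContinuousOnInterval.disjWithin a b)) (𝓝 0) := by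
    simpa using Tendsto.const_mul (K : ℝ) hf
  refine squeeze_zero' (Eventually.of_forall fun E => Finset.sum_nonneg fun _ _ => dist_nonneg)
    ?_ h0
  filter_upwards [mem_inf_of_right (mem_principal_self _)] with E hE
  rw [Finset.mul_sum]
  exact Finset.sum_le_sum fun i hi =>
    hg.dist_le_mul _ (hs (hE.1 i hi).1) _ (hs (hE.1 i hi).2)

theorem AbsolutelyContinuousOnInterval.re {f : ℝ → ℂ} {a b : ℝ}
    (hf : AbsolutelyContinuousOnInterval f a b) :
    AbsolutelyContinuousOnInterval (fun s => (f s).re) a b :=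
  (Complex.reCLM.lipschitz.lipschitzOnWith (s := Set.univ)).comp_absolutelyContinuousOnInterval hf
    (Set.mapsTo_univ _ _)

theorem AbsolutelyContinuousOnInterval.im {f : ℝ → ℂ} {a b : ℝ}
    (hf : AbsolutelyContinuousOnInterval f a b) :
    AbsolutelyContinuousOnInterval (fun s => (f s).im) a b :=
  (Complex.imCLM.lipschitz.lipschitzOnWith (s := Set.univ)).comp_absolutelyContinuousOnInterval hf
    (Set.mapsTo_univ _ _)

theorem HasDerivAt.complex_re {f : ℝ → ℂ} {f' : ℂ} {s : ℝ} (h : HasDerivAt f f' s) :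
    HasDerivAt (fun s => (f s).re) f'.re s :=
  Complex.reCLM.hasFDerivAt.comp_hasDerivAt s h

theorem HasDerivAt.complex_im {f : ℝ → ℂ} {f' : ℂ} {s : ℝ} (h : HasDerivAt f f' s) :
    HasDerivAt (fun s => (f s).im) f'.im s :=
  Complex.imCLM.hasFDerivAt.comp_hasDerivAt s h

theorem AbsolutelyContinuousOnInterval.ae_differentiableAt_complex {f : ℝ → ℂ} {a b : ℝ}
    (hf : AbsolutelyContinuousOnInterval f a b) :
    ∀ᵐ s, s ∈ Set.uIcc a b → DifferentiableAt ℝ f s := by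
  filter_upwards [hf.re.ae_differentiableAt, hf.im.ae_differentiableAt] with s h1 h2 hs
  have h := ((h1 hs).hasDerivAt.ofReal_comp).add
    (((h2 hs).hasDerivAt.ofReal_comp).mul_const Complex.I)
  refine (h.congr_of_eventuallyEq (Eventually.of_forall fun x => ?_)).differentiableAt
  exact (Complex.re_add_im (f x)).symm

/-- The fundamental theorem of calculus along an absolutely continuous curve. -/
theorem integral_comp_mul_deriv_curve {γ : ℝ → ℂ} {a b : ℝ}
    (hγ : AbsolutelyContinuousOnInterval γ a b) {U : Set ℂ} (hU : IsOpen U)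
    (hγU : Set.MapsTo γ (Set.uIcc a b) U) {F F' : ℂ → ℂ}
    (hF : ∀ t ∈ U, HasDerivAt F (F' t) t) :
    ∫ s in a..b, F' (γ s) * deriv γ s = F (γ b) - F (γ a) := by
  -- A holomorphic `F` is Lipschitz on the compact trace of the curve, so `F ∘ γ` is absolutely
  -- continuous and the real theorem applies to its real and imaginary parts.
  have hloc : LocallyLipschitzOn (γ '' Set.uIcc a b) F := by
    rintro _ ⟨s, hs, rfl⟩
    have hd : DifferentiableOn ℂ F U := fun t ht => (hF t ht).differentiableAt.differentiableWithinAt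
    have := ((hd.analyticAt (hU.mem_nhds (hγU hs))).contDiffAt (n := 1)).exists_lipschitzOnWith
    obtain ⟨K, t, ht, hK⟩ := this
    exact ⟨K, t, mem_nhdsWithin_of_mem_nhds ht, hK⟩
  obtain ⟨K, hK⟩ := hloc.exists_lipschitzOnWith_of_compact
    (isCompact_uIcc.image_of_continuousOn hγ.continuousOn)
  have hG := hK.comp_absolutelyContinuousOnInterval hγ (Set.mapsTo_image _ _)
  have hderiv : ∀ᵐ s, s ∈ Set.uIcc a b → HasDerivAt (F ∘ γ) (F' (γ s) * deriv γ s) s := by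
    filter_upwards [hγ.ae_differentiableAt_complex] with s h hs
    exact (hF _ (hγU hs)).comp s (h hs).hasDerivAt
  have hre : ∀ᵐ s, s ∈ Set.uIoc a b → F' (γ s) * deriv γ s =
      ((deriv (fun s => (F (γ s)).re) s : ℝ) : ℂ) +
        ((deriv (fun s => (F (γ s)).im) s : ℝ) : ℂ) * Complex.I := by
    filter_upwards [hderiv] with s h hs
    have h' := h (Set.uIoc_subset_uIcc hs)
    rw [show deriv (fun s => (F (γ s)).re) s = _ from h'.complex_re.deriv,
      show deriv (fun s => (F (γ s)).im) s = _ from h'.complex_im.deriv, Complex.re_add_im]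
  rw [intervalIntegral.integral_congr_ae hre, intervalIntegral.integral_add,
    intervalIntegral.integral_mul_const, intervalIntegral.integral_ofReal,
    intervalIntegral.integral_ofReal]
  · have h1 := hG.re.integral_deriv_eq_sub
    have h2 := hG.im.integral_deriv_eq_sub
    simp only [Function.comp_apply] at h1 h2
    rw [h1, h2]
    apply Complex.ext <;> simp
  · have := hG.re.intervalIntegrable_deriv
    exact ⟨this.1.ofReal, this.2.ofReal⟩
  · have := hG.im.intervalIntegrable_deriv
    exact IntervalIntegrable.mul_const ⟨this.1.ofReal, this.2.ofReal⟩ _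

/-! ### Branches of the logarithms and of the weight. -/

/-- `L₁` and `L₂` are holomorphic branches of `log (1 - t)` and `log (1 + t)` on the open
set `U`. -/
structure IsLogPair (U : Set ℂ) (L₁ L₂ : ℂ → ℂ) : Prop where
  isOpen : IsOpen U
  exp_left : ∀ t ∈ U, Complex.exp (L₁ t) = 1 - t
  exp_right : ∀ t ∈ U, Complex.exp (L₂ t) = 1 + t
  deriv_left : ∀ t ∈ U, HasDerivAt L₁ (-(1 - t)⁻¹) t
  deriv_right : ∀ t ∈ U, HasDerivAt L₂ (1 + t)⁻¹ t

/-- The branch of `(1 - t)^a (1 + t)^b` belonging to the branches `L₁`, `L₂` of the logarithms. -/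
noncomputable def weightFun (L₁ L₂ : ℂ → ℂ) (a b : ℝ) (t : ℂ) : ℂ :=
  Complex.exp (a * L₁ t + b * L₂ t)

namespace IsLogPair

variable {U : Set ℂ} {L₁ L₂ : ℂ → ℂ}

theorem one_sub_ne (h : IsLogPair U L₁ L₂) {t : ℂ} (ht : t ∈ U) : 1 - t ≠ 0 := by
  rw [← h.exp_left t ht]; exact Complex.exp_ne_zero _

theorem one_add_ne (h : IsLogPair U L₁ L₂) {t : ℂ} (ht : t ∈ U) : 1 + t ≠ 0 := by
  rw [← h.exp_right t ht]; exact Complex.exp_ne_zero _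

theorem hasDerivAt_weightFun (h : IsLogPair U L₁ L₂) (a b : ℝ) {t : ℂ} (ht : t ∈ U) :
    HasDerivAt (weightFun L₁ L₂ a b)
      (weightFun L₁ L₂ a b t * (a * -(1 - t)⁻¹ + b * (1 + t)⁻¹)) t :=
  (((h.deriv_left t ht).const_mul (a : ℂ)).add ((h.deriv_right t ht).const_mul (b : ℂ))).cexp

theorem hasDerivAt_weightFun_mul (h : IsLogPair U L₁ L₂) (a b : ℝ) (f : ℂ[X]) {t : ℂ}
    (ht : t ∈ U) :
    HasDerivAt (fun t => weightFun L₁ L₂ a b t * ((1 - t) * (1 + t) * f.eval t))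
      ((jacobiOp a b f).eval t * weightFun L₁ L₂ a b t) t := by
  have h1 := h.one_sub_ne ht
  have h2 := h.one_add_ne ht
  have hp : HasDerivAt (fun t : ℂ => (1 - t) * (1 + t) * f.eval t)
      ((-1 * (1 + t) + (1 - t) * 1) * f.eval t + (1 - t) * (1 + t) * (derivative f).eval t) t :=
    (((hasDerivAt_id t).const_sub 1).mul ((hasDerivAt_id t).const_add 1)).mul (f.hasDerivAt t)
  refine ((h.hasDerivAt_weightFun a b ht).mul hp).congr_deriv ?_
  simp only [jacobiOp, eval_add, eval_mul, eval_sub, eval_one, eval_pow, eval_X, eval_C]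
  field_simp
  ring

theorem norm_weightFun (h : IsLogPair U L₁ L₂) (a b : ℝ) {t : ℂ} (ht : t ∈ U) :
    ‖weightFun L₁ L₂ a b t‖ = ‖1 - t‖ ^ a * ‖1 + t‖ ^ b := by
  rw [weightFun, Complex.norm_exp, ← h.exp_left t ht, ← h.exp_right t ht, Complex.norm_exp,
    Complex.norm_exp, ← Real.exp_mul, ← Real.exp_mul, ← Real.exp_add]
  simp [mul_comm]

theorem weightFun_add_one_left (h : IsLogPair U L₁ L₂) (a b : ℝ) {t : ℂ} (ht : t ∈ U) :
    weightFun L₁ L₂ (a + 1) b t = (1 - t) * weightFun L₁ L₂ a b t := by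
  rw [weightFun, weightFun, ← h.exp_left t ht, ← Complex.exp_add]
  congr 1; push_cast; ring

theorem weightFun_add_one_right (h : IsLogPair U L₁ L₂) (a b : ℝ) {t : ℂ} (ht : t ∈ U) :
    weightFun L₁ L₂ a (b + 1) t = (1 + t) * weightFun L₁ L₂ a b t := by
  rw [weightFun, weightFun, ← h.exp_right t ht, ← Complex.exp_add]
  congr 1; push_cast; ring

/-- Two continuous branches of the weight along a curve differ by a constant factor. -/
theorem exists_eq_mul_weightFun (h : IsLogPair U L₁ L₂) {a b : ℝ} {γ w : ℝ → ℂ}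
    (hγ : ContinuousOn γ (Set.Ioo 0 1)) (hγU : Set.MapsTo γ (Set.Ioo 0 1) U)
    (hw : IsWeightBranch a b γ w) :
    ∃ κ : ℂ, κ ≠ 0 ∧ ∀ s ∈ Set.Ioo (0 : ℝ) 1, w s = κ * weightFun L₁ L₂ a b (γ s) := by
  -- The ratio of two branches always lies in the countable set `range e`; being continuous on an
  -- interval, it is constant.
  let e : ℤ × ℤ → ℂ := fun k =>
    Complex.exp (a * (k.1 * (2 * Real.pi * Complex.I)) + b * (k.2 * (2 * Real.pi * Complex.I)))
  have hne : ∀ t, weightFun L₁ L₂ a b t ≠ 0 := fun t => Complex.exp_ne_zero _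
  have hmem : ∀ s ∈ Set.Ioo (0 : ℝ) 1, w s / weightFun L₁ L₂ a b (γ s) ∈ Set.range e := by
    intro s hs
    obtain ⟨l₁, l₂, h1, h2, h3⟩ := hw.2 s hs
    rw [← h.exp_left _ (hγU hs), Complex.exp_eq_exp_iff_exists_int] at h1
    rw [add_comm, ← h.exp_right _ (hγU hs), Complex.exp_eq_exp_iff_exists_int] at h2
    obtain ⟨k₁, rfl⟩ := h1
    obtain ⟨k₂, rfl⟩ := h2
    refine ⟨(k₁, k₂), ?_⟩
    rw [h3, weightFun, ← Complex.exp_sub]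
    simp only [e]
    congr 1; ring
  have hcont : ContinuousOn (fun s => w s / weightFun L₁ L₂ a b (γ s)) (Set.Ioo 0 1) := by
    refine hw.1.div (ContinuousOn.comp (g := weightFun L₁ L₂ a b) (t := U) (fun t ht => ?_) hγ hγU)
      fun s _ => hne _
    exact (h.hasDerivAt_weightFun a b ht).continuousAt.continuousWithinAt
  have hsub := (Set.countable_range e).isTotallyDisconnected _ (Set.image_subset_iff.2 hmem)
    (isPreconnected_Ioo.image _ hcont)
  have h2 : (1 / 2 : ℝ) ∈ Set.Ioo (0 : ℝ) 1 := by norm_num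
  refine ⟨w (1 / 2) / weightFun L₁ L₂ a b (γ (1 / 2)), ?_, fun s hs => ?_⟩
  · obtain ⟨k, hk⟩ := hmem _ h2
    rw [← hk]
    exact Complex.exp_ne_zero _
  · have hs' : w s / weightFun L₁ L₂ a b (γ s) = w (1 / 2) / weightFun L₁ L₂ a b (γ (1 / 2)) :=
      hsub ⟨s, hs, rfl⟩ ⟨_, h2, rfl⟩
    rw [← hs', div_mul_cancel₀ _ (hne _)]

end IsLogPair

theorem IsOpenCurve.continuousOn {γ : ℝ → ℂ} (hγ : IsOpenCurve γ) :
    ContinuousOn γ (Set.Ioo 0 1) := by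
  intro s hs
  have h := (hγ (s / 2) ((s + 1) / 2) (by linarith [hs.1]) (by linarith [hs.2])
    (by linarith [hs.2])).continuousOn
  rw [Set.uIcc_of_le (by linarith [hs.2])] at h
  exact (h.continuousAt (Icc_mem_nhds (by linarith [hs.1]) (by linarith [hs.2]))).continuousWithinAt

/-! ### From vanishing integrals to exactness. -/

/-- `F` is a primitive of `g` on `U`, and has limits along `l₀` and `l₁` that differ by `I`. -/
structure HasPrimitiveWithJump (U : Set ℂ) (l₀ l₁ : Filter ℂ) (g F : ℂ → ℂ) (I : ℂ) : Prop where
  hasDerivAt : ∀ t ∈ U, HasDerivAt F (g t) t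
  limits : ∃ y₀ y₁, Tendsto F l₀ (𝓝 y₀) ∧ Tendsto F l₁ (𝓝 y₁) ∧ y₁ - y₀ = I

theorem HasPrimitiveWithJump.hasContourIntegral {U : Set ℂ} (hU : IsOpen U) {l₀ l₁ : Filter ℂ}
    {F W : ℂ → ℂ} {I κ : ℂ} {g : ℂ[X]}
    (h : HasPrimitiveWithJump U l₀ l₁ (fun t => g.eval t * W t) F I) {γ w : ℝ → ℂ}
    (hγ : IsOpenCurve γ) (hγU : Set.MapsTo γ (Set.Ioo 0 1) U)
    (h0 : Tendsto γ (𝓝[>] 0) l₀) (h1 : Tendsto γ (𝓝[<] 1) l₁)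
    (hw : ∀ s ∈ Set.Ioo (0 : ℝ) 1, w s = κ * W (γ s)) :
    HasContourIntegral γ w g (κ * I) := by
  obtain ⟨y₀, y₁, hy₀, hy₁, rfl⟩ := h.limits
  have hlim : Tendsto (fun ab : ℝ × ℝ => κ * (F (γ ab.2) - F (γ ab.1)))
      ((𝓝[>] (0 : ℝ)) ×ˢ (𝓝[<] (1 : ℝ))) (𝓝 (κ * (y₁ - y₀))) :=
    (((hy₁.comp h1).comp tendsto_snd).sub ((hy₀.comp h0).comp tendsto_fst)).const_mul κ
  refine hlim.congr' ?_
  have hev : ∀ᶠ ab : ℝ × ℝ in (𝓝[>] (0 : ℝ)) ×ˢ (𝓝[<] (1 : ℝ)),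
      ab.1 ∈ Set.Ioo (0 : ℝ) (1 / 2) ∧ ab.2 ∈ Set.Ioo (1 / 2 : ℝ) 1 :=
    Eventually.prod_mk (Ioo_mem_nhdsGT (by norm_num : (0 : ℝ) < 1 / 2))
      (Ioo_mem_nhdsLT (by norm_num : (1 / 2 : ℝ) < 1))
  filter_upwards [hev] with ab hab
  have hle : ab.1 ≤ ab.2 := by linarith [hab.1.2, hab.2.1]
  have hsub : Set.uIcc ab.1 ab.2 ⊆ Set.Ioo 0 1 := by
    rw [Set.uIcc_of_le hle]
    exact fun s hs => ⟨hab.1.1.trans_le hs.1, hs.2.trans_lt hab.2.2⟩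
  rw [← integral_comp_mul_deriv_curve (hγ _ _ hab.1.1 hle hab.2.2) hU
    (hγU.mono_left hsub) h.hasDerivAt, ← intervalIntegral.integral_const_mul]
  refine intervalIntegral.integral_congr fun s hs => ?_
  simp only [hw s (hsub hs)]
  ring

theorem HasContourIntegral.unique {γ w : ℝ → ℂ} {g : ℂ[X]} {I J : ℂ}
    (hI : HasContourIntegral γ w g I) (hJ : HasContourIntegral γ w g J) : I = J :=
  tendsto_nhds_unique hI hJ

/-- If the weight itself has a nonzero integral and the boundary terms vanish, then the vanishing
of the integrals of polynomials against the weight is equivalent to exactness. -/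
theorem IsLogPair.hasContourIntegral_zero_iff {U : Set ℂ} {L₁ L₂ : ℂ → ℂ} (h : IsLogPair U L₁ L₂)
    {l₀ l₁ : Filter ℂ} {a b : ℝ} (hab : ∀ m : ℤ, a + b ≠ m) {F : ℂ → ℂ} {I : ℂ} (hI : I ≠ 0)
    (hF : HasPrimitiveWithJump U l₀ l₁ (weightFun L₁ L₂ a b) F I) {N : ℕ}
    (hbd₀ : ∀ f : ℂ[X], f.natDegree ≤ N - 1 → Tendsto
      (fun t => weightFun L₁ L₂ a b t * ((1 - t) * (1 + t) * f.eval t)) l₀ (𝓝 0))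
    (hbd₁ : ∀ f : ℂ[X], f.natDegree ≤ N - 1 → Tendsto
      (fun t => weightFun L₁ L₂ a b t * ((1 - t) * (1 + t) * f.eval t)) l₁ (𝓝 0))
    {γ w : ℝ → ℂ} (hγ : IsOpenCurve γ) (hγU : Set.MapsTo γ (Set.Ioo 0 1) U)
    (h0 : Tendsto γ (𝓝[>] 0) l₀) (h1 : Tendsto γ (𝓝[<] 1) l₁) (hw : IsWeightBranch a b γ w)
    {g : ℂ[X]} (hg : g.natDegree ≤ N) :
    HasContourIntegral γ w g 0 ↔ IsJacobiExact a b g := by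
  have hab' : ∀ m : ℤ, (a : ℂ) + b ≠ m := fun m hm => hab m (by exact_mod_cast hm)
  obtain ⟨κ, hκ, hwκ⟩ := h.exists_eq_mul_weightFun hγ.continuousOn hγU hw
  obtain ⟨f, c, hf, rfl⟩ := exists_jacobiOp_add_C hab' N g hg
  -- The exact part has zero boundary values, so the whole jump `c * I` comes from the constant.
  have hprim : HasPrimitiveWithJump U l₀ l₁
      (fun t => (jacobiOp a b f + C c).eval t * weightFun L₁ L₂ a b t)
      (fun t => weightFun L₁ L₂ a b t * ((1 - t) * (1 + t) * f.eval t) + c * F t) (c * I) := by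
    refine ⟨fun t ht => ?_, ?_⟩
    · refine ((h.hasDerivAt_weightFun_mul a b f ht).add
        ((hF.hasDerivAt t ht).const_mul c)).congr_deriv ?_
      simp only [eval_add, eval_C]; ring
    · obtain ⟨y₀, y₁, hy₀, hy₁, rfl⟩ := hF.limits
      exact ⟨_, _, (hbd₀ f hf).add (hy₀.const_mul c), (hbd₁ f hf).add (hy₁.const_mul c), by ring⟩
  have hint := hprim.hasContourIntegral h.isOpen hγ hγU h0 h1 hwκ
  constructor
  · intro hz
    have hc : c = 0 := by simpa [hκ, hI] using hint.unique hz
    exact ⟨f, by simp [hc]⟩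
  · intro hex
    have hc : c = 0 := isJacobiExact_C hab' (by
      simpa using hex.sub ⟨f, rfl⟩)
    simpa [hc] using hint

/-! ### The Euler integral. -/

/-- The Euler type integral `∫₀¹ r^b (2 - r z)^c dr`. -/
noncomputable def eulerIntegral (c b : ℝ) (z : ℂ) : ℂ :=
  ∫ r in (0 : ℝ)..1, ((r ^ b : ℝ) : ℂ) * (2 - r * z) ^ (c : ℂ)

theorem two_sub_mul_mem_slitPlane {z : ℂ} (hz : 2 - z ∈ Complex.slitPlane) {r : ℝ}
    (hr : r ∈ Set.Icc (0 : ℝ) 1) : 2 - r * z ∈ Complex.slitPlane := by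
  rw [Complex.mem_slitPlane_iff] at hz ⊢
  simp only [Complex.sub_re, Complex.sub_im, Complex.re_ofReal_mul, Complex.im_ofReal_mul,
    Complex.re_ofNat, Complex.im_ofNat] at hz ⊢
  rcases hr.1.eq_or_lt with h0 | h0
  · left; rw [← h0]; norm_num
  · rcases hz with h | h
    · left; nlinarith [hr.2]
    · right
      have : z.im ≠ 0 := fun h' => h (by simp [h'])
      simpa [h0.ne'] using this

/-- Formally `z^(b+1) * eulerIntegral c b z` is `∫₀^z u^b (2 - u)^c du`, by `u = r z`. The
differential equation expresses this without choosing a branch of `z^b`. -/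
theorem hasDerivAt_eulerIntegral {c b : ℝ} (hb : 0 < b) {z : ℂ}
    (hz : 2 - z ∈ Complex.slitPlane) :
    ∃ H', HasDerivAt (eulerIntegral c b) H' z ∧
      z * H' + (b + 1) * eulerIntegral c b z = (2 - z) ^ (c : ℂ) := by
  let F' : ℂ → ℝ → ℂ := fun z r =>
    ((r ^ b : ℝ) : ℂ) * (c * (2 - r * z) ^ ((c : ℂ) - 1) * -(r : ℂ))
  have hrpow : Continuous fun r : ℝ => ((r ^ b : ℝ) : ℂ) :=
    Complex.continuous_ofReal.comp (Real.continuous_rpow_const hb.le)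
  have hcpow : ∀ (e : ℂ) {z : ℂ}, 2 - z ∈ Complex.slitPlane →
      ContinuousOn (fun r : ℝ => (2 - (r : ℂ) * z) ^ e) (Set.uIcc 0 1) := by
    intro e z hz
    rw [Set.uIcc_of_le zero_le_one]
    exact ContinuousOn.cpow_const (by fun_prop) fun r hr => two_sub_mul_mem_slitPlane hz hr
  have hV : IsOpen {z : ℂ | 2 - z ∈ Complex.slitPlane} :=
    Complex.isOpen_slitPlane.preimage (by fun_prop)
  obtain ⟨ε, hε, hball⟩ := Metric.nhds_basis_closedBall.mem_iff.1 (hV.mem_nhds hz)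
  obtain ⟨M, hM⟩ := ((isCompact_closedBall z ε).prod (isCompact_Icc (a := (0 : ℝ)) (b := 1))
    ).exists_bound_of_continuousOn (f := fun p : ℂ × ℝ => F' p.1 p.2) (by
      refine ((hrpow.comp continuous_snd).continuousOn).mul ((continuousOn_const.mul ?_).mul
        (by fun_prop))
      exact ContinuousOn.cpow_const (by fun_prop) fun p hp =>
        two_sub_mul_mem_slitPlane (hball hp.1) hp.2)
  have hFint : ∀ {z : ℂ}, 2 - z ∈ Complex.slitPlane → ContinuousOn
      (fun r : ℝ => ((r ^ b : ℝ) : ℂ) * (2 - r * z) ^ (c : ℂ)) (Set.uIcc 0 1) := fun hz =>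
    hrpow.continuousOn.mul (hcpow _ hz)
  have hF'c : ContinuousOn (F' z) (Set.uIcc 0 1) :=
    hrpow.continuousOn.mul ((continuousOn_const.mul (hcpow _ hz)).mul (by fun_prop))
  have hIoc : Set.uIoc (0 : ℝ) 1 ⊆ Set.Icc 0 1 := by
    rw [Set.uIoc_of_le zero_le_one]; exact Set.Ioc_subset_Icc_self
  have hmeas : ∀ {f : ℝ → ℂ}, ContinuousOn f (Set.uIcc 0 1) → MeasureTheory.AEStronglyMeasurable f
      (MeasureTheory.volume.restrict (Set.uIoc 0 1)) := fun hf =>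
    (hf.mono Set.uIoc_subset_uIcc).aestronglyMeasurable measurableSet_uIoc
  have key := intervalIntegral.hasDerivAt_integral_of_dominated_loc_of_deriv_le
    (μ := MeasureTheory.volume) (a := 0) (b := 1) (bound := fun _ => M) (F' := F')
    (F := fun z r => ((r ^ b : ℝ) : ℂ) * (2 - r * z) ^ (c : ℂ)) (x₀ := z)
    (Metric.closedBall_mem_nhds z hε)
    (by
      filter_upwards [Metric.closedBall_mem_nhds z hε] with x hx
      exact hmeas (hFint (hball hx)))
    (hFint hz).intervalIntegrable (hmeas hF'c)
    (Eventually.of_forall fun r hr x hx => hM (x, r) ⟨hx, hIoc hr⟩)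
    intervalIntegrable_const
    (Eventually.of_forall fun r hr x hx => by
      have h1 : HasDerivAt (fun x : ℂ => 2 - (r : ℂ) * x) (-(r : ℂ)) x := by
        simpa using ((hasDerivAt_id x).const_mul (r : ℂ)).const_sub 2
      exact (h1.cpow_const (two_sub_mul_mem_slitPlane (hball hx) (hIoc hr))).const_mul _)
  refine ⟨_, key.2, ?_⟩
  -- The equation is the integral over `[0, 1]` of the `r`-derivative of `r^(b+1) (2 - r z)^c`.
  have hftc := intervalIntegral.integral_eq_sub_of_hasDerivAt (a := 0) (b := 1)
    (f := fun r : ℝ => ((r ^ (b + 1) : ℝ) : ℂ) * (2 - r * z) ^ (c : ℂ))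
    (f' := fun r : ℝ => z * F' z r + (b + 1) * (((r ^ b : ℝ) : ℂ) * (2 - r * z) ^ (c : ℂ)))
    (fun r hr => by
      rw [Set.uIcc_of_le zero_le_one] at hr
      have h1 : HasDerivAt (fun r : ℝ => 2 - (r : ℂ) * z) (-z) r := by
        simpa using ((Complex.ofRealCLM.hasDerivAt (x := r)).mul_const z).const_sub 2
      have h2 : HasDerivAt (fun r : ℝ => ((r ^ (b + 1) : ℝ) : ℂ))
          (((b + 1) * r ^ (b + 1 - 1) : ℝ) : ℂ) r :=
        (Real.hasDerivAt_rpow_const (Or.inr (by linarith))).ofReal_comp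
      have h3 := (hasDerivAt_id (2 - (r : ℂ) * z)).cpow_const (c := (c : ℂ))
        (two_sub_mul_mem_slitPlane hz hr)
      have h4 := h3.comp r h1
      refine (h2.mul h4).congr_deriv ?_
      have h5 : r ^ (b + 1) = r ^ b * r := Real.rpow_add_one' hr.1 (by linarith)
      simp only [F', id, Function.comp_apply, add_sub_cancel_right, h5]
      push_cast
      ring)
    (((continuousOn_const.mul hF'c).add (continuousOn_const.mul (hFint hz))).intervalIntegrable)
  rw [intervalIntegral.integral_add, intervalIntegral.integral_const_mul,
    intervalIntegral.integral_const_mul] at hftc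
  · rw [eulerIntegral, hftc]
    simp [Real.zero_rpow (by linarith : b + 1 ≠ 0)]
  · exact (continuousOn_const.mul hF'c).intervalIntegrable
  · exact (continuousOn_const.mul (hFint hz)).intervalIntegrable

/-- The point `2` corresponds to the end point `t = 1` and is outside the reach of
`hasDerivAt_eulerIntegral`. The bound `5` comes from `‖z‖ ≤ 3` and `r ≤ 1`. -/
theorem continuousAt_eulerIntegral_two {c b : ℝ} (hc : 0 < c) (hb : 0 < b) :
    ContinuousAt (eulerIntegral c b) 2 := by
  refine intervalIntegral.continuousAt_of_dominated_interval (bound := fun _ => 5 ^ c)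
    (Eventually.of_forall fun z => ?_) ?_ intervalIntegrable_const
    (Eventually.of_forall fun r hr => ?_)
  · refine Measurable.aestronglyMeasurable ?_
    fun_prop
  · filter_upwards [Metric.ball_mem_nhds (2 : ℂ) one_pos] with z hz
    refine Eventually.of_forall fun r hr => ?_
    rw [Set.uIoc_of_le zero_le_one] at hr
    rw [norm_mul, Complex.norm_cpow_real, Complex.norm_real,
      Real.norm_of_nonneg (Real.rpow_nonneg hr.1.le _)]
    have h1 : r ^ b ≤ 1 := Real.rpow_le_one hr.1.le hr.2 hb.le
    have hz3 : ‖z‖ ≤ 3 := by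
      have h := norm_le_norm_add_norm_sub' z 2
      rw [Metric.mem_ball, dist_eq_norm] at hz
      rw [norm_sub_rev] at hz
      rw [norm_sub_rev] at h
      norm_num at h
      linarith
    have h2 : ‖2 - (r : ℂ) * z‖ ≤ 5 := by
      refine (norm_sub_le _ _).trans ?_
      rw [norm_mul, Complex.norm_real, Real.norm_of_nonneg hr.1.le]
      norm_num
      nlinarith [norm_nonneg z, hr.2, hr.1]
    have h3 : ‖2 - (r : ℂ) * z‖ ^ c ≤ 5 ^ c := Real.rpow_le_rpow (norm_nonneg _) h2 hc.le
    have h4 : 0 ≤ ‖2 - (r : ℂ) * z‖ ^ c := Real.rpow_nonneg (norm_nonneg _) _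
    nlinarith [Real.rpow_nonneg hr.1.le b]
  · rw [Set.uIoc_of_le zero_le_one] at hr
    refine ContinuousAt.mul continuousAt_const ?_
    refine ContinuousAt.comp (g := fun x : ℂ => x ^ (c : ℂ)) (f := fun z : ℂ => 2 - (r : ℂ) * z)
      ?_ (by fun_prop)
    refine Complex.continuousAt_cpow_const_of_re_pos (Or.inl ?_) (by simpa using hc)
    simp
    linarith [hr.2]

theorem eulerIntegral_two_ne_zero {c b : ℝ} (hc : 0 < c) (hb : 0 < b) :
    eulerIntegral c b 2 ≠ 0 := by
  have h : eulerIntegral c b 2 =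
      ((∫ r in (0 : ℝ)..1, r ^ b * (2 - r * 2) ^ c : ℝ) : ℂ) := by
    rw [eulerIntegral, ← intervalIntegral.integral_ofReal]
    refine intervalIntegral.integral_congr fun r hr => ?_
    rw [Set.uIcc_of_le zero_le_one] at hr
    simp only [Complex.ofReal_mul]
    rw [Complex.ofReal_cpow (by linarith [hr.2] : 0 ≤ 2 - r * 2)]
    push_cast
    rfl
  rw [h, Complex.ofReal_ne_zero]
  refine (intervalIntegral.intervalIntegral_pos_of_pos_on ?_ (fun r hr => ?_) zero_lt_one).ne'
  · refine Continuous.intervalIntegrable ?_ _ _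
    exact (Real.continuous_rpow_const hb.le).mul
      ((Real.continuous_rpow_const hc.le).comp (by fun_prop))
  · exact mul_pos (Real.rpow_pos_of_pos hr.1 _) (Real.rpow_pos_of_pos (by linarith [hr.2]) _)

/-! ### The contour Γ₁. -/

/-- The plane slit along `[-1, ∞)`. -/
def slitRight : Set ℂ := {t | -(1 + t) ∈ Complex.slitPlane}

/-- The branch of `log (1 + t)` on `slitRight`. -/
noncomputable def logRight (t : ℂ) : ℂ := Complex.log (-(1 + t)) + Real.pi * Complex.I

theorem mem_slitRight_iff {t : ℂ} : t ∈ slitRight ↔ t.re < -1 ∨ t.im ≠ 0 := by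
  rw [slitRight, Set.mem_ofPred_eq, Complex.mem_slitPlane_iff]
  simp
  constructor <;> rintro (h | h) <;> first | (left; linarith) | (right; exact h)

theorem one_sub_mem_slitPlane {t : ℂ} (ht : t ∈ slitRight) : 1 - t ∈ Complex.slitPlane := by
  rw [mem_slitRight_iff] at ht
  rw [Complex.mem_slitPlane_iff]
  simp
  rcases ht with h | h
  · left; linarith
  · right; exact h

theorem isLogPair_slitRight :
    IsLogPair slitRight (fun t => Complex.log (1 - t)) logRight where
  isOpen := Complex.isOpen_slitPlane.preimage (by fun_prop)
  exp_left t ht := Complex.exp_log (Complex.slitPlane_ne_zero (one_sub_mem_slitPlane ht))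
  exp_right t ht := by
    rw [logRight, Complex.exp_add, Complex.exp_log (Complex.slitPlane_ne_zero ht),
      Complex.exp_pi_mul_I]
    ring
  deriv_left t ht := by
    refine (((hasDerivAt_id t).const_sub 1).clog (one_sub_mem_slitPlane ht)).congr_deriv ?_
    simp [neg_div]
  deriv_right t ht := by
    refine (((((hasDerivAt_id t).const_add 1).neg).clog ht).add_const _).congr_deriv ?_
    change -1 / -(1 + t) = _
    rw [neg_div_neg_eq, one_div]

/-- The weight on `slitRight`. -/
noncomputable abbrev weightRight : ℝ → ℝ → ℂ → ℂ :=
  weightFun (fun t => Complex.log (1 - t)) logRight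

/-- From above, `-(1 + t)` reaches `-2` through the lower half plane, where the argument tends to
`-π` and cancels the added `πi`. From below the two add up to `2πi`, which is the source of the
nonzero jump. -/
theorem tendsto_logRight_upper :
    Tendsto logRight (𝓝[{t | 0 < t.im}] 1) (𝓝 (Real.log 2 : ℂ)) := by
  have h := Complex.tendsto_log_nhdsWithin_im_neg_of_re_neg_of_im_zero (z := -2) (by simp) (by simp)
  have hm : Tendsto (fun t : ℂ => -(1 + t)) (𝓝[{t | 0 < t.im}] 1) (𝓝[{z | z.im < 0}] (-2)) := by
    refine tendsto_nhdsWithin_iff.2 ⟨?_, ?_⟩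
    · refine tendsto_nhdsWithin_of_tendsto_nhds ?_
      have : ContinuousAt (fun t : ℂ => -(1 + t)) 1 := by fun_prop
      convert this.tendsto using 2
      norm_num
    · filter_upwards [self_mem_nhdsWithin] with t ht
      simpa using ht
  have := (h.comp hm).add_const (Real.pi * Complex.I)
  rw [norm_neg, Complex.norm_two, sub_add_cancel] at this
  exact this

theorem tendsto_logRight_lower :
    Tendsto logRight (𝓝[{t | t.im < 0}] 1) (𝓝 (Real.log 2 + 2 * Real.pi * Complex.I : ℂ)) := by
  have h := Complex.tendsto_log_nhdsWithin_im_nonneg_of_re_neg_of_im_zero (z := -2) (by simp)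
    (by simp)
  have hm : Tendsto (fun t : ℂ => -(1 + t)) (𝓝[{t | t.im < 0}] 1) (𝓝[{z | 0 ≤ z.im}] (-2)) := by
    refine tendsto_nhdsWithin_iff.2 ⟨?_, ?_⟩
    · refine tendsto_nhdsWithin_of_tendsto_nhds ?_
      have : ContinuousAt (fun t : ℂ => -(1 + t)) 1 := by fun_prop
      convert this.tendsto using 2
      norm_num
    · filter_upwards [self_mem_nhdsWithin] with t ht
      simpa using le_of_lt ht
  have := (h.comp hm).add_const (Real.pi * Complex.I)
  rw [norm_neg, Complex.norm_two, add_assoc, ← two_mul, ← mul_assoc] at this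
  exact this

theorem exp_mul_two_pi_ne_one {b : ℝ} (hb : ∀ m : ℤ, b ≠ m) :
    Complex.exp (b * (2 * Real.pi * Complex.I)) ≠ 1 := by
  rw [Ne, Complex.exp_eq_one_iff]
  rintro ⟨m, hm⟩
  have := mul_right_cancel₀ Complex.two_pi_I_ne_zero hm
  exact hb m (by exact_mod_cast this)

/-- The property that `∫ w(t; c, b) dt` along curves from `1 - i0` to `1 + i0` converges and is not
zero. -/
def HasNonzeroJump (c b : ℝ) : Prop :=
  ∃ F I, I ≠ 0 ∧ HasPrimitiveWithJump slitRight (𝓝[{t | t.im < 0}] 1) (𝓝[{t | 0 < t.im}] 1)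
    (weightRight c b) F I

/-- The Euler integral has the same limit from both sides of `1`, so only `(1 + t)^b` jumps. The
jump is a nonzero multiple of `1 - exp(2πib)`, which is nonzero since `b` is not an integer. -/
theorem hasNonzeroJump_of_pos {c b : ℝ} (hc : 0 < c) (hb : 0 < b) (hbZ : ∀ m : ℤ, b ≠ m) :
    HasNonzeroJump c b := by
  let F : ℂ → ℂ := fun t =>
    (1 + t) * Complex.exp (b * logRight t) * eulerIntegral c b (1 + t)
  have hH : Tendsto (fun t : ℂ => eulerIntegral c b (1 + t)) (𝓝 1) (𝓝 (eulerIntegral c b 2)) := by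
    refine (continuousAt_eulerIntegral_two hc hb).tendsto.comp ?_
    have : ContinuousAt (fun t : ℂ => 1 + t) 1 := by fun_prop
    convert this.tendsto using 2
    norm_num
  have hid : Tendsto (fun t : ℂ => 1 + t) (𝓝 1) (𝓝 2) := by
    have : ContinuousAt (fun t : ℂ => 1 + t) 1 := by fun_prop
    convert this.tendsto using 2
    norm_num
  have hlim : ∀ {l : Filter ℂ} {y : ℂ}, l ≤ 𝓝 1 → Tendsto logRight l (𝓝 y) →
      Tendsto F l (𝓝 (2 * Complex.exp (b * y) * eulerIntegral c b 2)) := fun hl hy =>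
    ((hid.mono_left hl).mul
      ((Complex.continuous_exp.tendsto _).comp (hy.const_mul (b : ℂ)))).mul (hH.mono_left hl)
  refine ⟨F, _, ?_, ⟨fun t ht => ?_, _, _, hlim nhdsWithin_le_nhds tendsto_logRight_lower,
    hlim nhdsWithin_le_nhds tendsto_logRight_upper, rfl⟩⟩
  · rw [mul_add, Complex.exp_add, show ∀ x y H : ℂ, 2 * x * H - 2 * (x * y) * H =
      2 * x * H * (1 - y) by intros; ring]
    refine mul_ne_zero (mul_ne_zero (mul_ne_zero two_ne_zero (Complex.exp_ne_zero _))
      (eulerIntegral_two_ne_zero hc hb)) (sub_ne_zero.2 (exp_mul_two_pi_ne_one hbZ).symm)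
  · have hz : 2 - (1 + t) ∈ Complex.slitPlane := by
      convert one_sub_mem_slitPlane ht using 1; ring
    obtain ⟨H', hH', hrel⟩ := hasDerivAt_eulerIntegral (c := c) hb hz
    have h0 := isLogPair_slitRight.one_add_ne ht
    have h1 : HasDerivAt (fun t : ℂ => 1 + t) 1 t := (hasDerivAt_id t).const_add 1
    have h2 : HasDerivAt (fun t => eulerIntegral c b (1 + t)) H' t := by
      have := hH'.comp t h1
      rwa [mul_one] at this
    have h3 := ((isLogPair_slitRight.deriv_right t ht).const_mul (b : ℂ)).cexp
    refine ((h1.mul h3).mul h2).congr_deriv ?_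
    have hw : weightRight c b t = Complex.exp (b * logRight t) * (2 - (1 + t)) ^ (c : ℂ) := by
      rw [weightRight, weightFun, Complex.exp_add, Complex.cpow_def_of_ne_zero
        (Complex.slitPlane_ne_zero hz), mul_comm, show 2 - (1 + t) = 1 - t by ring,
        mul_comm (Complex.log _)]
    rw [hw, ← hrel]
    simp only [Pi.mul_apply]
    field_simp
    ring

theorem upper_subset_slitRight : {t : ℂ | 0 < t.im} ⊆ slitRight := fun _ ht =>
  mem_slitRight_iff.2 (Or.inr (ne_of_gt ht))

theorem lower_subset_slitRight : {t : ℂ | t.im < 0} ⊆ slitRight := fun _ ht =>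
  mem_slitRight_iff.2 (Or.inr (ne_of_lt ht))

/-- The boundary terms at `1` vanish. -/
theorem tendsto_weightRight_mul {c b : ℝ} (hc : -1 < c) (f : ℂ[X]) {s : Set ℂ}
    (hs : s ⊆ slitRight) :
    Tendsto (fun t => weightRight c b t * ((1 - t) * (1 + t) * f.eval t)) (𝓝[s] 1) (𝓝 0) := by
  have h1 : Tendsto (fun t : ℂ => ‖1 - t‖ ^ (c + 1) * (‖1 + t‖ ^ b * ‖(1 + t) * f.eval t‖)) (𝓝 1)
      (𝓝 0) := by
    have : ContinuousAt
        (fun t : ℂ => ‖1 - t‖ ^ (c + 1) * (‖1 + t‖ ^ b * ‖(1 + t) * f.eval t‖)) 1 := by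
      refine ContinuousAt.mul (ContinuousAt.rpow_const (by fun_prop) (Or.inr (by linarith)))
        (ContinuousAt.mul (ContinuousAt.rpow_const (by fun_prop) (Or.inl (by norm_num)))
          (by fun_prop))
    have h := this.tendsto
    simpa [Real.zero_rpow (by linarith : c + 1 ≠ 0)] using h
  refine squeeze_zero_norm' ?_ (tendsto_nhdsWithin_of_tendsto_nhds h1)
  filter_upwards [self_mem_nhdsWithin] with t ht
  have ht' := hs ht
  rw [norm_mul, isLogPair_slitRight.norm_weightFun c b ht', Real.rpow_add_one
    (norm_ne_zero_iff.2 (isLogPair_slitRight.one_sub_ne ht')), mul_assoc, mul_assoc (1 - t),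
    norm_mul (1 - t)]
  exact le_of_eq (by ring)

/-- From `jacobiOp c b 1 + (c + b + 2)(1 + X) = 2(b + 1)`: up to boundary terms that vanish at `1`,
the integrals for `b` and `b + 1` are proportional. -/
theorem HasNonzeroJump.of_add_one_right {c b : ℝ} (hc : -1 < c) (hb : b ≠ -1)
    (hcb : c + b + 2 ≠ 0) (h : HasNonzeroJump c (b + 1)) : HasNonzeroJump c b := by
  obtain ⟨F, I, hI, hF⟩ := h
  have hb' : (2 * (b + 1) : ℂ) ≠ 0 := mul_ne_zero two_ne_zero fun h => hb (by
    have : (b : ℂ) = (-1 : ℝ) := by push_cast; linear_combination h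
    exact_mod_cast this)
  have hcb' : (c + b + 2 : ℂ) ≠ 0 := by exact_mod_cast hcb
  refine ⟨fun t => (2 * (b + 1) : ℂ)⁻¹ * (weightRight c b t * ((1 - t) * (1 + t) *
    (1 : ℂ[X]).eval t) + (c + b + 2) * F t), (2 * (b + 1) : ℂ)⁻¹ * ((c + b + 2) * I),
    mul_ne_zero (inv_ne_zero hb') (mul_ne_zero hcb' hI), ⟨fun t ht => ?_, ?_⟩⟩
  · refine (((isLogPair_slitRight.hasDerivAt_weightFun_mul c b 1 ht).add
      ((hF.hasDerivAt t ht).const_mul _)).const_mul _).congr_deriv ?_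
    simp only [weightRight]
    rw [isLogPair_slitRight.weightFun_add_one_right c b ht, inv_mul_eq_iff_eq_mul₀ hb']
    simp [jacobiOp]
    ring
  · obtain ⟨y₀, y₁, hy₀, hy₁, rfl⟩ := hF.limits
    exact ⟨_, _, ((tendsto_weightRight_mul hc 1 lower_subset_slitRight).add
      (hy₀.const_mul _)).const_mul _, ((tendsto_weightRight_mul hc 1 upper_subset_slitRight).add
      (hy₁.const_mul _)).const_mul _, by ring⟩

theorem HasNonzeroJump.of_add_one_left {c b : ℝ} (hc : -1 < c)
    (hcb : c + b + 2 ≠ 0) (h : HasNonzeroJump (c + 1) b) : HasNonzeroJump c b := by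
  obtain ⟨F, I, hI, hF⟩ := h
  have hc' : (-(2 * (c + 1)) : ℂ) ≠ 0 := neg_ne_zero.2 (mul_ne_zero two_ne_zero fun h => hc.ne' (by
    have : (c : ℂ) = (-1 : ℝ) := by push_cast; linear_combination h
    exact_mod_cast this))
  have hcb' : (c + b + 2 : ℂ) ≠ 0 := by exact_mod_cast hcb
  refine ⟨fun t => (-(2 * (c + 1)) : ℂ)⁻¹ * (weightRight c b t * ((1 - t) * (1 + t) *
    (1 : ℂ[X]).eval t) - (c + b + 2) * F t), (-(2 * (c + 1)) : ℂ)⁻¹ * (-((c + b + 2) * I)),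
    mul_ne_zero (inv_ne_zero hc') (neg_ne_zero.2 (mul_ne_zero hcb' hI)), ⟨fun t ht => ?_, ?_⟩⟩
  · refine (((isLogPair_slitRight.hasDerivAt_weightFun_mul c b 1 ht).sub
      ((hF.hasDerivAt t ht).const_mul _)).const_mul _).congr_deriv ?_
    simp only [weightRight]
    rw [isLogPair_slitRight.weightFun_add_one_left c b ht, inv_mul_eq_iff_eq_mul₀ hc']
    simp [jacobiOp]
    ring
  · obtain ⟨y₀, y₁, hy₀, hy₁, rfl⟩ := hF.limits
    exact ⟨_, _, ((tendsto_weightRight_mul hc 1 lower_subset_slitRight).sub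
      (hy₀.const_mul _)).const_mul _, ((tendsto_weightRight_mul hc 1 upper_subset_slitRight).sub
      (hy₁.const_mul _)).const_mul _, by ring⟩

theorem hasNonzeroJump {c b : ℝ} (hc : -1 < c) (hb : ∀ m : ℤ, b ≠ m)
    (hcb : ∀ m : ℤ, c + b ≠ m) : HasNonzeroJump c b := by
  obtain ⟨N, hN⟩ := exists_nat_gt (-b)
  -- One step makes the first exponent positive, since `c > -1`; `N` further steps do so for the
  -- second.
  refine HasNonzeroJump.of_add_one_left hc
    (fun h => hcb (-2) (by push_cast; linarith)) ?_
  induction N generalizing b with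
  | zero => exact hasNonzeroJump_of_pos (by linarith) (by simpa using hN) hb
  | succ N ih =>
    refine HasNonzeroJump.of_add_one_right (by linarith)
      (fun h => hb (-1) (by push_cast; linarith)) (fun h => hcb (-3) (by push_cast; linarith))
      (ih (fun m h => hb (m - 1) (by push_cast; linarith))
        (fun m h => hcb (m - 1) (by push_cast; linarith)) (by push_cast at hN; linarith))

theorem IsGammaOne.mapsTo {γ : ℝ → ℂ} (hγ : IsGammaOne γ) :
    Set.MapsTo γ (Set.Ioo 0 1) slitRight := by
  intro s hs
  rw [mem_slitRight_iff]
  by_contra! h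
  exact hγ.avoids s hs (γ s).re h.1 (Complex.ext (by simp) (by simp [h.2]))

/-- On `Γ₁`, the integrals that vanish are those of exact polynomials. -/
theorem IsGammaOne.hasContourIntegral_zero_iff {a b : ℝ} (ha : -1 < a) (hb : ∀ m : ℤ, b ≠ m)
    (hab : ∀ m : ℤ, a + b ≠ m) {γ w : ℝ → ℂ} (hγ : IsGammaOne γ) (hw : IsWeightBranch a b γ w)
    (g : ℂ[X]) : HasContourIntegral γ w g 0 ↔ IsJacobiExact a b g := by
  obtain ⟨F, I, hI, hF⟩ := hasNonzeroJump ha hb hab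
  exact isLogPair_slitRight.hasContourIntegral_zero_iff hab hI hF
    (fun f _ => tendsto_weightRight_mul ha f lower_subset_slitRight)
    (fun f _ => tendsto_weightRight_mul ha f upper_subset_slitRight) hγ.curve hγ.mapsTo
    (tendsto_nhdsWithin_iff.2 ⟨hγ.start, hγ.start_side⟩)
    (tendsto_nhdsWithin_iff.2 ⟨hγ.finish, hγ.finish_side⟩) hw le_rfl

/-! ### The contour Γ₋₁, by reflection. -/

theorem isLogPair_slitLeft :
    IsLogPair {t | -t ∈ slitRight} (fun t => logRight (-t)) (fun t => Complex.log (1 + t)) where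
  isOpen := isLogPair_slitRight.isOpen.preimage continuous_neg
  exp_left t ht := by
    rw [isLogPair_slitRight.exp_right _ ht]; ring
  exp_right t ht := by
    have := isLogPair_slitRight.exp_left _ ht
    rwa [sub_neg_eq_add] at this
  deriv_left t ht := by
    refine ((isLogPair_slitRight.deriv_right _ ht).comp t (hasDerivAt_neg t)).congr_deriv ?_
    rw [← sub_eq_add_neg, mul_neg_one]
  deriv_right t ht := by
    have h := (isLogPair_slitRight.deriv_left _ ht).comp t (hasDerivAt_neg t)
    rw [neg_mul_neg, mul_one] at h
    simp only [Function.comp_def, sub_neg_eq_add] at h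
    exact h

theorem weightFun_slitLeft (a b : ℝ) (t : ℂ) :
    weightFun (fun t => logRight (-t)) (fun t => Complex.log (1 + t)) a b t =
      weightRight b a (-t) := by
  simp only [weightRight, weightFun, sub_neg_eq_add]
  rw [add_comm]

/-- On `Γ₋₁`, the integrals that vanish are those of exact polynomials. -/
theorem IsGammaNegOne.hasContourIntegral_zero_iff {a b : ℝ} (hb : -1 < b) (ha : ∀ m : ℤ, a ≠ m)
    (hab : ∀ m : ℤ, a + b ≠ m) {γ w : ℝ → ℂ} (hγ : IsGammaNegOne γ) (hw : IsWeightBranch a b γ w)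
    (g : ℂ[X]) : HasContourIntegral γ w g 0 ↔ IsJacobiExact a b g := by
  obtain ⟨F, I, hI, hF⟩ := hasNonzeroJump hb ha (fun m => by rw [add_comm]; exact hab m)
  have hneg : Tendsto (fun t : ℂ => -t) (𝓝 (-1)) (𝓝 1) := by
    simpa using (continuous_neg.tendsto (-1 : ℂ))
  have hbd : ∀ (f : ℂ[X]) {l : Filter ℂ}, (∀ f : ℂ[X], Tendsto
      (fun t => weightRight b a t * ((1 - t) * (1 + t) * f.eval t)) l (𝓝 0)) → Tendsto (fun t =>
        weightFun (fun t => logRight (-t)) (fun t => Complex.log (1 + t)) a b t *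
          ((1 - t) * (1 + t) * f.eval t)) (comap Neg.neg l) (𝓝 0) := by
    intro f l h
    refine ((h (f.comp (-X))).comp tendsto_comap).congr fun t => ?_
    rw [weightFun_slitLeft]
    simp only [Function.comp_apply, eval_comp, eval_neg, eval_X, neg_neg]
    ring
  refine isLogPair_slitLeft.hasContourIntegral_zero_iff (F := fun t => -F (-t)) hab
    (neg_ne_zero.2 hI) ⟨fun t ht => ?_, ?_⟩ (N := g.natDegree)
    (fun f _ => hbd f fun f => tendsto_weightRight_mul hb f lower_subset_slitRight)
    (fun f _ => hbd f fun f => tendsto_weightRight_mul hb f upper_subset_slitRight) hγ.curve ?_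
    (tendsto_comap_iff.2 (tendsto_nhdsWithin_iff.2 ⟨hneg.comp hγ.start, ?_⟩))
    (tendsto_comap_iff.2 (tendsto_nhdsWithin_iff.2 ⟨hneg.comp hγ.finish, ?_⟩)) hw le_rfl
  · refine ((hF.hasDerivAt (-t) ht).comp t (hasDerivAt_neg t)).neg.congr_deriv ?_
    rw [weightFun_slitLeft]; ring
  · obtain ⟨y₀, y₁, hy₀, hy₁, rfl⟩ := hF.limits
    exact ⟨_, _, (hy₀.comp tendsto_comap).neg, (hy₁.comp tendsto_comap).neg, by ring⟩
  · intro s hs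
    refine mem_slitRight_iff.2 ?_
    by_contra! h
    simp only [Complex.neg_re, Complex.neg_im, neg_eq_zero] at h
    exact hγ.avoids s hs (γ s).re (by linarith [h.1]) (Complex.ext (by simp) (by simp [h.2]))
  · filter_upwards [hγ.start_side] with s hs
    simpa using hs
  · filter_upwards [hγ.finish_side] with s hs
    simpa using hs

/-! ### The contour Γ_∞, by a Möbius map. -/

/-- The Möbius map that fixes `-1`, takes `∞` to `1` and `1` to `∞`. -/
noncomputable def moebius (t : ℂ) : ℂ := 1 - 4 / (1 - t)

/-- The preimage of `slitRight` under `moebius`, which is the plane slit along `(-∞, -1]` and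
`[1, ∞)`. -/
def slitOuter : Set ℂ := {t | 1 - t ≠ 0 ∧ moebius t ∈ slitRight}

theorem hasDerivAt_moebius {t : ℂ} (ht : 1 - t ≠ 0) :
    HasDerivAt moebius (-4 / (1 - t) ^ 2) t := by
  have h1 : HasDerivAt (fun t : ℂ => 1 - t) (-1) t := (hasDerivAt_id t).const_sub 1
  refine (((hasDerivAt_const t (4 : ℂ)).div h1 ht).const_sub 1).congr_deriv ?_
  field_simp
  ring

/-- The branch of `log (1 - t)` on `slitOuter`. -/
noncomputable def logOuterLeft (t : ℂ) : ℂ := Complex.log 4 - Complex.log (1 - moebius t)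

/-- The branch of `log (1 + t)` on `slitOuter`. -/
noncomputable def logOuterRight (t : ℂ) : ℂ :=
  -- Here `1 + t = -(1/2) (1 + moebius t) (1 - t)`, and `πi - log 2` is a logarithm of `-1/2`.
  logRight (moebius t) + logOuterLeft t + (Real.pi * Complex.I - Complex.log 2)

theorem isOpen_slitOuter : IsOpen slitOuter := by
  have h1 : IsOpen {t : ℂ | 1 - t ≠ 0} := isOpen_ne_fun (by fun_prop) (by fun_prop)
  have h2 : ContinuousOn moebius {t : ℂ | 1 - t ≠ 0} := fun t ht =>
    (hasDerivAt_moebius ht).continuousAt.continuousWithinAt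
  exact h2.isOpen_inter_preimage h1 isLogPair_slitRight.isOpen

theorem isLogPair_slitOuter : IsLogPair slitOuter logOuterLeft logOuterRight := by
  have e1 : ∀ t ∈ slitOuter, Complex.exp (logOuterLeft t) = 1 - t := fun t ht => by
    have h := ht.1
    rw [logOuterLeft, Complex.exp_sub, isLogPair_slitRight.exp_left _ ht.2,
      Complex.exp_log (by norm_num), moebius]
    field_simp
    ring
  have d1 : ∀ t ∈ slitOuter, HasDerivAt logOuterLeft (-(1 - t)⁻¹) t := fun t ht => by
    have h := ht.1
    refine (((isLogPair_slitRight.deriv_left _ ht.2).comp t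
      (hasDerivAt_moebius ht.1)).const_sub _).congr_deriv ?_
    rw [moebius, sub_sub_cancel]
    field_simp
  refine ⟨isOpen_slitOuter, e1, fun t ht => ?_, d1, fun t ht => ?_⟩
  · have h := ht.1
    rw [logOuterRight, Complex.exp_add, Complex.exp_add, e1 t ht, Complex.exp_sub,
      isLogPair_slitRight.exp_right _ ht.2, Complex.exp_log two_ne_zero, Complex.exp_pi_mul_I,
      moebius]
    field_simp
    ring
  · have h := ht.1
    have h2 := isLogPair_slitRight.one_add_ne ht.2
    refine ((((isLogPair_slitRight.deriv_right _ ht.2).comp t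
      (hasDerivAt_moebius ht.1)).add (d1 t ht)).add_const _).congr_deriv ?_
    have h3 : 1 + moebius t = -2 * (1 + t) / (1 - t) := by
      rw [moebius]; field_simp; ring
    have h4 : 1 + t ≠ 0 := fun h' => h2 (by rw [h3, h']; simp)
    rw [h3]
    field_simp
    ring

/-- With `s = moebius t`, `1 - s = 4/(1 - t)` and `1 + s = -2(1 + t)/(1 - t)`. The exponent `-a - b
- 2` is chosen so that the surplus factor is `(1 - t)^2`, which cancels against `ds/dt = -4/(1 -
t)^2`. -/
theorem weightRight_moebius (a b : ℝ) {t : ℂ} (ht : t ∈ slitOuter) :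
    weightRight (-a - b - 2) b (moebius t) =
      Complex.exp ((-a - b - 2) * Complex.log 4 - b * (Real.pi * Complex.I - Complex.log 2)) *
        ((1 - t) ^ 2 * weightFun logOuterLeft logOuterRight a b t) := by
  rw [← isLogPair_slitOuter.exp_left t ht, ← Complex.exp_nat_mul]
  simp only [weightRight, weightFun]
  rw [← Complex.exp_add, ← Complex.exp_add]
  congr 1
  simp only [logOuterRight, logOuterLeft]
  push_cast
  ring

theorem tendsto_moebius {l : Filter ℂ} (hl : l ≤ Bornology.cobounded ℂ) :
    Tendsto moebius l (𝓝 1) := by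
  have h1 : Tendsto (fun t : ℂ => 1 - t) l (Bornology.cobounded ℂ) := by
    have : Tendsto (fun t : ℂ => ‖1 - t‖) (Bornology.cobounded ℂ) atTop := by
      refine tendsto_atTop_mono (fun t => ?_)
        (tendsto_atTop_add_const_right _ (-1) tendsto_norm_cobounded_atTop)
      have := norm_sub_norm_le t 1
      rw [norm_one, norm_sub_rev] at this
      linarith
    exact (tendsto_norm_atTop_iff_cobounded.1 this).mono_left hl
  have h2 := ((tendsto_inv₀_cobounded.comp h1).const_mul 4).const_sub 1
  rw [mul_zero, sub_zero] at h2
  exact h2.congr fun t => by simp only [moebius, div_eq_mul_inv, Function.comp_apply]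

theorem moebius_im (t : ℂ) : (moebius t).im = -(4 * t.im / Complex.normSq (1 - t)) := by
  rw [moebius, div_eq_mul_inv, Complex.sub_im, Complex.mul_im, Complex.inv_im]
  simp
  ring

theorem normSq_one_sub_pos {t : ℂ} (ht : t.im ≠ 0) : 0 < Complex.normSq (1 - t) :=
  Complex.normSq_pos.2 fun h => ht (by simpa using congrArg Complex.im h)

theorem upper_subset_slitOuter : {t : ℂ | 0 < t.im} ⊆ slitOuter := fun t ht => by
  have hn := normSq_one_sub_pos (ne_of_gt ht)
  refine ⟨Complex.normSq_pos.1 hn, lower_subset_slitRight ?_⟩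
  rw [Set.mem_ofPred_eq, moebius_im]
  exact neg_neg_of_pos (div_pos (mul_pos four_pos ht) hn)

theorem lower_subset_slitOuter : {t : ℂ | t.im < 0} ⊆ slitOuter := fun t ht => by
  have hn := normSq_one_sub_pos (ne_of_lt ht)
  refine ⟨Complex.normSq_pos.1 hn, upper_subset_slitRight ?_⟩
  rw [Set.mem_ofPred_eq, moebius_im]
  exact neg_pos_of_neg (div_neg_of_neg_of_pos (mul_neg_of_pos_of_neg four_pos ht) hn)

theorem IsGammaInfty.mapsTo {γ : ℝ → ℂ} (hγ : IsGammaInfty γ) :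
    Set.MapsTo γ (Set.Ioo 0 1) slitOuter := by
  intro s hs
  rcases lt_trichotomy (γ s).im 0 with h | h | h
  · exact lower_subset_slitOuter h
  · have hx : γ s = ((γ s).re : ℂ) := Complex.ext (by simp) (by simp [h])
    set x := (γ s).re
    have hx1 : -1 < x ∧ x < 1 := by
      by_contra! hc
      refine hγ.avoids s hs x ?_ hx
      by_cases h' : -1 < x
      · exact Or.inr (hc h')
      · exact Or.inl (not_lt.1 h')
    rw [hx]
    refine ⟨fun h' => ?_, mem_slitRight_iff.2 (Or.inl ?_)⟩
    · have : (1 - x : ℝ) = 0 := by exact_mod_cast h'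
      linarith [hx1.2]
    · have : moebius (x : ℂ) = ((1 - 4 / (1 - x) : ℝ) : ℂ) := by
        rw [moebius]; push_cast; rfl
      rw [this, Complex.ofReal_re]
      have : 2 < 4 / (1 - x) := by
        rw [lt_div_iff₀ (by linarith [hx1.2])]; linarith [hx1.1]
      linarith
  · exact upper_subset_slitOuter h

/-- The boundary terms at `∞` vanish. -/
theorem tendsto_weightOuter_mul {a b : ℝ} (ha : a < -1) (hb : b < -1) {d : ℕ}
    (hd : a + b + 2 + d < 0) {f : ℂ[X]} (hf : f.natDegree ≤ d) {s : Set ℂ} (hs : s ⊆ slitOuter) :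
    Tendsto (fun t => weightFun logOuterLeft logOuterRight a b t * ((1 - t) * (1 + t) * f.eval t))
      (Bornology.cobounded ℂ ⊓ 𝓟 s) (𝓝 0) := by
  have hnorm : Tendsto (fun t : ℂ => ‖t‖) (Bornology.cobounded ℂ ⊓ 𝓟 s) atTop :=
    tendsto_norm_cobounded_atTop.mono_left inf_le_left
  -- For `‖t‖ ≥ 2` both `‖1 - t‖` and `‖1 + t‖` are at least `‖t‖ / 2`; the exponents `a + 1`, `b +
  -- 1` are negative, so this bounds the powers from above.
  set K : ℝ := (1 / 2) ^ (a + 1) * (1 / 2) ^ (b + 1) * ∑ i ∈ Finset.range (d + 1), ‖f.coeff i‖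
  have hlim : Tendsto (fun t : ℂ => K * ‖t‖ ^ (a + b + 2 + d)) (Bornology.cobounded ℂ ⊓ 𝓟 s)
      (𝓝 0) := by
    have h := ((tendsto_rpow_neg_atTop (y := -(a + b + 2 + d)) (by linarith)).comp
      hnorm).const_mul K
    simpa [Function.comp_def] using h
  refine squeeze_zero_norm' ?_ hlim
  filter_upwards [hnorm.eventually_ge_atTop 2, mem_inf_of_right (mem_principal_self s)]
    with t ht hts
  have ht0 : 0 < ‖t‖ := by linarith
  have htU := hs hts
  have h1 : (1 / 2) * ‖t‖ ≤ ‖1 - t‖ := by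
    have := norm_sub_norm_le t 1
    rw [norm_one, norm_sub_rev] at this
    linarith
  have h2 : (1 / 2) * ‖t‖ ≤ ‖1 + t‖ := by
    have := norm_sub_norm_le t (-1)
    rw [norm_neg, norm_one, sub_neg_eq_add, add_comm] at this
    linarith
  have hfb : ‖f.eval t‖ ≤ (∑ i ∈ Finset.range (d + 1), ‖f.coeff i‖) * ‖t‖ ^ (d : ℝ) := by
    rw [eval_eq_sum_range' (Nat.lt_succ_of_le hf), Real.rpow_natCast, Finset.sum_mul]
    refine (norm_sum_le _ _).trans (Finset.sum_le_sum fun i hi => ?_)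
    rw [norm_mul, norm_pow]
    exact mul_le_mul_of_nonneg_left (pow_le_pow_right₀ (by linarith)
      (Nat.lt_succ_iff.1 (Finset.mem_range.1 hi))) (norm_nonneg _)
  have hp1 : ‖1 - t‖ ^ (a + 1) ≤ (1 / 2) ^ (a + 1) * ‖t‖ ^ (a + 1) := by
    rw [← Real.mul_rpow (by norm_num) ht0.le]
    exact Real.rpow_le_rpow_of_nonpos (by positivity) h1 (by linarith)
  have hp2 : ‖1 + t‖ ^ (b + 1) ≤ (1 / 2) ^ (b + 1) * ‖t‖ ^ (b + 1) := by
    rw [← Real.mul_rpow (by norm_num) ht0.le]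
    exact Real.rpow_le_rpow_of_nonpos (by positivity) h2 (by linarith)
  calc ‖weightFun logOuterLeft logOuterRight a b t * ((1 - t) * (1 + t) * f.eval t)‖
      = ‖1 - t‖ ^ (a + 1) * ‖1 + t‖ ^ (b + 1) * ‖f.eval t‖ := by
        rw [norm_mul, isLogPair_slitOuter.norm_weightFun a b htU, norm_mul, norm_mul,
          Real.rpow_add_one (norm_ne_zero_iff.2 (isLogPair_slitOuter.one_sub_ne htU)),
          Real.rpow_add_one (norm_ne_zero_iff.2 (isLogPair_slitOuter.one_add_ne htU))]
        ring
    _ ≤ ((1 / 2) ^ (a + 1) * ‖t‖ ^ (a + 1)) * ((1 / 2) ^ (b + 1) * ‖t‖ ^ (b + 1)) *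
        ((∑ i ∈ Finset.range (d + 1), ‖f.coeff i‖) * ‖t‖ ^ (d : ℝ)) := by gcongr
    _ = K * ‖t‖ ^ (a + b + 2 + d) := by
        rw [show a + b + 2 + d = ((a + 1) + (b + 1)) + d by ring, Real.rpow_add ht0 _ (d : ℝ),
          Real.rpow_add ht0 (a + 1)]
        simp only [K]
        ring

/-- On `Γ_∞`, the integrals that vanish are those of exact polynomials, as long as the integrals
converge. -/
theorem IsGammaInfty.hasContourIntegral_zero_iff {a b : ℝ} (ha1 : a < -1) (hb1 : b < -1)
    (ha : ∀ m : ℤ, a ≠ m) (hb : ∀ m : ℤ, b ≠ m) (hab : ∀ m : ℤ, a + b ≠ m) {γ w : ℝ → ℂ}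
    (hγ : IsGammaInfty γ) (hw : IsWeightBranch a b γ w) {d : ℕ} (hd : a + b + 2 + d < 0) {g : ℂ[X]}
    (hg : g.natDegree ≤ d + 1) : HasContourIntegral γ w g 0 ↔ IsJacobiExact a b g := by
  obtain ⟨F, I, hI, hF⟩ := hasNonzeroJump (c := -a - b - 2) (b := b)
    (by have : (0 : ℝ) ≤ d := Nat.cast_nonneg d
        linarith) hb
    (fun m h => ha (-m - 2) (by push_cast; linarith))
  set e := Complex.exp ((-a - b - 2) * Complex.log 4 - b * (Real.pi * Complex.I - Complex.log 2))
    with he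
  have he0 : (-4 * e)⁻¹ ≠ 0 :=
    inv_ne_zero (mul_ne_zero (by norm_num) (Complex.exp_ne_zero _))
  have hup : Tendsto moebius (Bornology.cobounded ℂ ⊓ 𝓟 {t | 0 < t.im}) (𝓝[{t | t.im < 0}] 1) := by
    refine tendsto_nhdsWithin_iff.2 ⟨tendsto_moebius inf_le_left, ?_⟩
    filter_upwards [mem_inf_of_right (mem_principal_self _)] with t ht
    rw [moebius_im]
    exact neg_neg_of_pos (div_pos (mul_pos four_pos ht) (normSq_one_sub_pos (ne_of_gt ht)))
  have hlow : Tendsto moebius (Bornology.cobounded ℂ ⊓ 𝓟 {t | t.im < 0})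
      (𝓝[{t | 0 < t.im}] 1) := by
    refine tendsto_nhdsWithin_iff.2 ⟨tendsto_moebius inf_le_left, ?_⟩
    filter_upwards [mem_inf_of_right (mem_principal_self _)] with t ht
    rw [moebius_im]
    exact neg_pos_of_neg (div_neg_of_neg_of_pos (mul_neg_of_pos_of_neg four_pos ht)
      (normSq_one_sub_pos (ne_of_lt ht)))
  refine isLogPair_slitOuter.hasContourIntegral_zero_iff (F := fun t => (-4 * e)⁻¹ * F (moebius t))
    (I := (-4 * e)⁻¹ * I) hab (mul_ne_zero he0 hI) ⟨fun t ht => ?_, ?_⟩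
    (fun f hf => tendsto_weightOuter_mul ha1 hb1 hd hf upper_subset_slitOuter)
    (fun f hf => tendsto_weightOuter_mul ha1 hb1 hd hf lower_subset_slitOuter) hγ.curve hγ.mapsTo
    (tendsto_inf.2 ⟨tendsto_norm_atTop_iff_cobounded.1 hγ.start, tendsto_principal.2 hγ.start_side⟩)
    (tendsto_inf.2 ⟨tendsto_norm_atTop_iff_cobounded.1 hγ.finish,
      tendsto_principal.2 hγ.finish_side⟩) hw hg
  · refine (((hF.hasDerivAt _ ht.2).comp t (hasDerivAt_moebius ht.1)).const_mul _).congr_deriv ?_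
    have h1 := ht.1
    rw [weightRight_moebius a b ht, ← he, inv_mul_eq_iff_eq_mul₀ (fun h => he0 (by rw [h, inv_zero]))]
    field_simp
  · obtain ⟨y₀, y₁, hy₀, hy₁, rfl⟩ := hF.limits
    exact ⟨_, _, (hy₀.comp hup).const_mul _, (hy₁.comp hlow).const_mul _, by ring⟩

/-! ### Assembling the three sets of conditions. -/

/-- Here `-1 < x + k` makes the boundary terms vanish at `±1`, and `x + k < 0`, strict because `x`
is not an integer, makes them vanish at `∞`. -/
theorem floor_neg_facts {x : ℝ} {n : ℕ} (hx : ∀ m : ℤ, x ≠ m) (hn : -(n : ℝ) < x) (h1 : x < -1) :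
    ∃ k : ℕ, ⌊-x⌋ = k ∧ 1 ≤ k ∧ k < n ∧ x + k < 0 ∧ -1 < x + k := by
  have h0 : 1 ≤ ⌊-x⌋ := Int.le_floor.2 (by push_cast; linarith)
  obtain ⟨k, hk⟩ := Int.eq_ofNat_of_zero_le (by linarith : 0 ≤ ⌊-x⌋)
  have h2 : (k : ℝ) ≤ -x := by
    have := Int.floor_le (-x)
    rw [hk] at this
    exact_mod_cast this
  have h3 : -x < k + 1 := by
    have := Int.lt_floor_add_one (-x)
    rw [hk] at this
    exact_mod_cast this
  have h4 : x + k ≠ 0 := fun h => hx (-k) (by push_cast; linarith)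
  refine ⟨k, hk, by omega, ?_, lt_of_le_of_ne (by linarith) h4, by linarith⟩
  have : (k : ℝ) < n := by linarith
  exact_mod_cast this

theorem natDegree_lt_of_degree_lt_of_pos {q : ℂ[X]} {k : ℕ} (hk : 0 < k) (h : q.degree < k) :
    q.natDegree < k := by
  by_cases h0 : q = 0
  · simpa [h0] using hk
  · exact (natDegree_lt_iff_degree_lt h0).2 h

/-- The three sets of conditions together say that `q p` is exact for all `q` of degree less
than `n`. -/
theorem multipleOrthogonality_iff (n : ℕ) (α β : ℝ)
    (hα : ∀ m : ℤ, α ≠ m) (hβ : ∀ m : ℤ, β ≠ m) (hαβ : ∀ m : ℤ, α + β ≠ m)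
    (hαn : -(n : ℝ) < α) (hβn : -(n : ℝ) < β) (hsum : α + β + n < -1)
    (γm γp γi wm wp wi : ℝ → ℂ)
    (hγm : IsGammaNegOne γm) (hγp : IsGammaOne γp) (hγi : IsGammaInfty γi)
    (hwm : IsWeightBranch α (β + ⌊-β⌋) γm wm)
    (hwp : IsWeightBranch (α + ⌊-α⌋) β γp wp)
    (hwi : IsWeightBranch α β γi wi) {p : ℂ[X]} (hp : p.natDegree ≤ n) :
    MultipleOrthogonality n α β γm wm γp wp γi wi p ↔
      ∀ q : ℂ[X], q.natDegree < n → IsJacobiExact α β (q * p) := by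
  -- From `β > -n` and `α + β + n < -1` follows `α < -1`, and symmetrically for `β`.
  obtain ⟨A, hA, hA1, hAn, hA0, hA2⟩ := floor_neg_facts hα hαn (by linarith)
  obtain ⟨B, hB, hB1, hBn, hB0, hB2⟩ := floor_neg_facts hβ hβn (by linarith)
  have hAB : n ≤ A + B := by
    have : (n : ℝ) < A + B + 1 := by linarith
    exact Nat.lt_succ_iff.1 (by exact_mod_cast this)
  have hα' : ∀ m : ℤ, (α : ℂ) ≠ m := fun m h => hα m (by exact_mod_cast h)
  have hβ' : ∀ m : ℤ, (β : ℂ) ≠ m := fun m h => hβ m (by exact_mod_cast h)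
  have hαβ' : ∀ m : ℤ, (α : ℂ) + β ≠ m := fun m h => hαβ m (by exact_mod_cast h)
  rw [hB] at hwm
  rw [hA] at hwp
  have hm : ∀ g : ℂ[X], HasContourIntegral γm wm g 0 ↔ IsJacobiExact α β ((1 + X) ^ B * g) := by
    intro g
    rw [isJacobiExact_one_add_X_pow_mul_iff hβ' hαβ',
      hγm.hasContourIntegral_zero_iff (a := α) (b := β + B) hB2 hα
        (fun m h => hαβ (m - B) (by push_cast; linarith)) (by push_cast at hwm ⊢; exact hwm)]
    push_cast
    rfl
  have hpl : ∀ g : ℂ[X], HasContourIntegral γp wp g 0 ↔ IsJacobiExact α β ((1 - X) ^ A * g) := by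
    intro g
    rw [isJacobiExact_one_sub_X_pow_mul_iff hα' hαβ',
      hγp.hasContourIntegral_zero_iff (a := α + A) (b := β) hA2 hβ
        (fun m h => hαβ (m - A) (by push_cast; linarith)) (by push_cast at hwp ⊢; exact hwp)]
    push_cast
    rfl
  have hi : ∀ g : ℂ[X], g.natDegree ≤ A + B - 1 →
      (HasContourIntegral γi wi g 0 ↔ IsJacobiExact α β g) := by
    intro g hg
    -- With `d = A + B - 2` the decay exponent `α + β + 2 + d` is `(α + A) + (β + B)`, a sum of two
    -- negative numbers.
    refine hγi.hasContourIntegral_zero_iff (by linarith) (by linarith) hα hβ hαβ hwi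
      (d := A + B - 2) ?_ (by omega)
    rw [Nat.cast_sub (by omega)]
    push_cast
    linarith
  unfold MultipleOrthogonality OrthogonalUpTo
  rw [hA, hB]
  constructor
  · rintro ⟨h1, h2, h3⟩ q hq
    obtain ⟨q₁, q₂, q₃, d1, d2, d3, rfl⟩ := exists_eq_pow_mul_add_pow_mul_add hAn.le hBn.le hAB
      ((degree_le_natDegree).trans_lt (by exact_mod_cast hq))
    have e1 : IsJacobiExact α β ((1 + X) ^ B * (q₁ * p)) := (hm _).1 (h1 q₁ (by
      have := natDegree_lt_of_degree_lt_of_pos (by omega) d1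
      omega))
    have e2 : IsJacobiExact α β ((1 - X) ^ A * (q₂ * p)) := (hpl _).1 (h2 q₂ (by
      have := natDegree_lt_of_degree_lt_of_pos (by omega) d2
      omega))
    have e3 : IsJacobiExact α β (q₃ * p) := by
      -- If `A + B = n`, then `q₃ = 0` and Γ_∞ carries no condition: even `natDegree 0 = 0` exceeds
      -- the bound `-1`.
      by_cases h0 : q₃ = 0
      · exact ⟨0, by simp [h0, jacobiOp]⟩
      have := (natDegree_lt_iff_degree_lt h0).2 d3
      refine (hi _ ?_).1 (h3 q₃ (by omega))
      exact natDegree_mul_le.trans (by omega)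
    have := (e1.add e2).add e3
    rwa [← mul_assoc, ← mul_assoc, ← add_mul, ← add_mul] at this
  · intro h
    have hpow : ∀ {ℓ q : ℂ[X]} {k : ℕ}, ℓ.natDegree = 1 → (ℓ ^ k * q).natDegree ≤ k + q.natDegree :=
      fun {ℓ q k} hℓ => natDegree_mul_le.trans (by rw [natDegree_pow, hℓ, mul_one])
    refine ⟨fun q hq => ?_, fun q hq => ?_, fun q hq => ?_⟩
    · rw [hm, ← mul_assoc]
      exact h _ ((hpow natDegree_one_add_X).trans_lt (by omega))
    · rw [hpl, ← mul_assoc]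
      exact h _ ((hpow natDegree_one_sub_X).trans_lt (by omega))
    · rw [hi _ (natDegree_mul_le.trans (by omega))]
      exact h _ (by omega)

theorem theorem6p4 (n : ℕ) (α β : ℝ)
    (hα : ∀ m : ℤ, α ≠ m) (hβ : ∀ m : ℤ, β ≠ m) (hαβ : ∀ m : ℤ, α + β ≠ m)
    (hαn : -(n : ℝ) < α) (hβn : -(n : ℝ) < β) (hsum : α + β + n < -1)
    (γm γp γi wm wp wi : ℝ → ℂ)
    (hγm : IsGammaNegOne γm) (hγp : IsGammaOne γp) (hγi : IsGammaInfty γi)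
    (hwm : IsWeightBranch α (β + ⌊-β⌋) γm wm)
    (hwp : IsWeightBranch (α + ⌊-α⌋) β γp wp)
    (hwi : IsWeightBranch α β γi wi) :
    (jacobiPoly n α β).degree = n ∧
      MultipleOrthogonality n α β γm wm γp wp γi wi (jacobiPoly n α β) ∧
        ∀ p : ℂ[X], p.degree ≤ n →
          MultipleOrthogonality n α β γm wm γp wp γi wi p →
            ∃ c : ℂ, p = C c * jacobiPoly n α β := by
  have hα' : ∀ m : ℤ, (α : ℂ) ≠ m := fun m h => hα m (by exact_mod_cast h)
  have hβ' : ∀ m : ℤ, (β : ℂ) ≠ m := fun m h => hβ m (by exact_mod_cast h)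
  have hαβ' : ∀ m : ℤ, (α : ℂ) + β ≠ m := fun m h => hαβ m (by exact_mod_cast h)
  have hiff : ∀ p : ℂ[X], p.natDegree ≤ n →
      (MultipleOrthogonality n α β γm wm γp wp γi wi p ↔ ∃ c : ℂ, p = C c * jacobiPoly n α β) :=
    fun p hp => (multipleOrthogonality_iff n α β hα hβ hαβ hαn hβn hsum γm γp γi wm wp wi
      hγm hγp hγi hwm hwp hwi hp).trans (forall_isJacobiExact_mul_iff n hα' hβ' hαβ' hp)
  obtain ⟨h0, hd⟩ := jacobiPoly_ne_zero_and_natDegree n hαβ'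
  exact ⟨by rw [degree_eq_natDegree h0, hd], (hiff _ hd.le).2 ⟨1, by simp⟩,
    fun p hp => (hiff p (natDegree_le_of_degree_le hp)).1⟩
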